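/- Consider a sequence of linear models $\mathbf{y}=\mathbf{X}\boldsymbol\beta+\boldsymbol\varepsilon$, $\boldsymbol\varepsilon\sim N(0,\sigma^2\mathbf I_n)$, $\sigma>0$, with deterministic designs $\mathbf X=(\mathbf x_1,\dots,\mathbf x_p)\in\mathbb R^{n\times p}$ standardized by $\|\mathbf x_j\|^2=n$; all of $n,p,\mathbf X,\boldsymbol\beta,\sigma$ and $d^*,c_*,c^*,\gamma$ below may vary along the sequence. For $A\subseteq\{1,\dots,p\}$ let $\mathbf X_A=(\mathbf x_j)_{j\in A}$ and $\boldsymbol\Sigma_A=\mathbf X_A'\mathbf X_A/n$. Let $A^\circ=\{j:\beta_j\ne0\}$, $d^\circ=|A^\circ|$, $\beta_*=\min_{j\in A^\circ}|\beta_j|$, let $w^\circ$ be the largest diagonal element of $\boldsymbol\Sigma_{A^\circ}^{-1}$, and let $\widehat{\boldsymbol\beta}^\circ=\arg\min_{\mathbf b}\{\|\mathbf y-\mathbf X\mathbf b\|^2: b_j=0\ \forall j\notin A^\circ\}$ be the oracle least squares estimator (LSE). Penalty and estimator. The minimax concave penalty is $\rho(t;\lambda)=\lambda\int_0^t(1-x/(\gamma\lambda))_+\,dx$,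 with derivative $\dot\rho(t;\lambda)=\lambda(1-t/(\gamma\lambda))_+$ in $t$. A pair $(\lambda,\mathbf b)$ is a critical point if $\mathbf x_j'(\mathbf y-\mathbf X\mathbf b)/n=\operatorname{sgn}(b_j)\dot\rho(|b_j|;\lambda)$ for $b_j\neq0$ and $|\mathbf x_j'(\mathbf y-\mathbf X\mathbf b)/n|\le\lambda$ for $b_j=0$. A main branch is a continuous path $x\mapsto(\lambda^{(x)},\widehat{\boldsymbol\beta}^{(x)})$, $x\ge0$, of critical points with $\lambda^{(x)}\ge 0$, $\widehat{\boldsymbol\beta}^{(0)}=\mathbf 0$ and $\lim_{x\to\infty}\lambda^{(x)}=0$. The MC+ estimator at level $\lambda$ is $\widehat{\boldsymbol\beta}(\lambda)=\widehat{\boldsymbol\beta}^{(x_\lambda)}$ with $x_\lambda=\inf\{x\ge0:\lambda^{(x)}\le\lambda\}$, taken along a main branch. Assumptions. The sparse Riesz condition holds with $0<c_*\le c^*<\infty$ and an integer rank $d^*\le p$: for all $|A|\le d^*$, $\min_{\|\mathbf u\|=1}\|\boldsymbol\Sigma_A\mathbf u\|\ge c_*$ and the largest eigenvalue of $\boldsymbol\Sigma_A$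 is at most $c^*$. Let $\lambda_{\rm univ}=\sigma\sqrt{(2/n)\log p}$, $m=d^*-d^\circ$, and let $\widetilde p_1$ be the solution with $2\log\widetilde p_1\ge1$ of $$2\log\widetilde p_1-1-\log(2\log\widetilde p_1)=\frac2m\log\binom{p-d^\circ}{m}.$$ Suppose $d^*/(c^*/c_*+1/2)\ge d^\circ\to\infty$, $\gamma\ge c_*^{-1}\sqrt{4+c_*/c^*}$ and $$\beta_*\ \ge\ \sigma\sqrt{w^\circ(2/n)\log d^\circ}+\gamma\max\Big\{2\sqrt{c^*}\,\sigma\sqrt{(2/n)\log\widetilde p_1},\ \lambda_{\rm univ}\Big\}.$$ Conclusion. $P\{\widehat{\boldsymbol\beta}(\lambda_{\rm univ})\ne\widehat{\boldsymbol\beta}^\circ\ \text{or}\ \operatorname{sgn}(\widehat{\boldsymbol\beta}(\lambda_{\rm univ}))\ne\operatorname{sgn}(\boldsymbol\beta)\}\to0$, where the event is that this occurs for the MC+ estimator taken along at least one main branch. -/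

import Mathlib

open MeasureTheory ProbabilityTheory Filter Topology

namespace MCPlus

/-- The minimax concave penalty `ρ(t; λ) = λ ∫_0^t (1 - x / (γ λ))_+ dx`. -/
noncomputable def mcp (γ lam t : ℝ) : ℝ :=
  lam * ∫ x in (0 : ℝ)..t, max (1 - x / (γ * lam)) 0

/-- The derivative `λ (1 - t / (γ λ))_+` of the minimax concave penalty in `t`. -/
noncomputable def mcpDeriv (γ lam t : ℝ) : ℝ :=
  lam * max (1 - t / (γ * lam)) 0

theorem hasDerivAt_mcp (γ lam t : ℝ) : HasDerivAt (mcp γ lam) (mcpDeriv γ lam t) t := by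
  have hc : Continuous fun x : ℝ => max (1 - x / (γ * lam)) 0 := by fun_prop
  exact (intervalIntegral.integral_hasDerivAt_right (hc.intervalIntegrable 0 t)
    (hc.stronglyMeasurableAtFilter _ _) hc.continuousAt).const_mul lam

section Design

variable {n p : ℕ}

/-- The support `A° = {j : β_j ≠ 0}`. -/
noncomputable def support (β : Fin p → ℝ) : Finset (Fin p) :=
  Finset.univ.filter fun j => β j ≠ 0

/-- The Gram matrix `Σ_A = X_A' X_A / n` of the columns of `X` with indices in `A`. -/
noncomputable def subGram (X : Matrix (Fin n) (Fin p) ℝ) (A : Finset (Fin p)) :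
    Matrix A A ℝ :=
  fun i j => (∑ k, X k i * X k j) / n

/-- The sparse Riesz condition with rank `d` and constants `cl = c_*`, `cu = c^*`: for `|A| ≤ d`,
`cl` is at most the minimum of `‖Σ_A u‖` over the unit vectors `u`, and the largest eigenvalue of
`Σ_A` is at most `cu`. -/
def SparseRiesz (X : Matrix (Fin n) (Fin p) ℝ) (d : ℕ) (cl cu : ℝ) : Prop :=
  0 < cl ∧ cl ≤ cu ∧ ∀ A : Finset (Fin p), A.card ≤ d →
    (∀ u : EuclideanSpace ℝ A, ‖u‖ = 1 → cl ≤ ‖Matrix.toEuclideanLin (subGram X A) u‖) ∧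
    (∀ μ : ℝ, Module.End.HasEigenvalue (Matrix.toEuclideanLin (subGram X A)) μ → μ ≤ cu)

/-- `w°`, the largest diagonal element of `Σ_A⁻¹`. -/
noncomputable def maxInvDiag (X : Matrix (Fin n) (Fin p) ℝ) (A : Finset (Fin p)) : ℝ :=
  ⨆ j : A, (subGram X A)⁻¹ j j

/-- `b` minimizes `‖y - X b‖²` subject to `b_j = 0` for all `j ∉ B`. -/
def IsLSE (X : Matrix (Fin n) (Fin p) ℝ) (y : Fin n → ℝ) (B : Finset (Fin p))
    (b : Fin p → ℝ) : Prop :=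
  (∀ j ∉ B, b j = 0) ∧ ∀ b' : Fin p → ℝ, (∀ j ∉ B, b' j = 0) →
    ∑ k, (y k - (X.mulVec b) k) ^ 2 ≤ ∑ k, (y k - (X.mulVec b') k) ^ 2

/-- `(lam, b)` is a critical point of the penalized loss
`‖y - X b‖² / (2 n) + ∑ j, mcp γ lam |b_j|`. -/
def IsCritical (X : Matrix (Fin n) (Fin p) ℝ) (y : Fin n → ℝ) (γ lam : ℝ)
    (b : Fin p → ℝ) : Prop :=
  ∀ j,
    (b j ≠ 0 →
      (∑ k, X k j * (y k - (X.mulVec b) k)) / n = Real.sign (b j) * mcpDeriv γ lam |b j|) ∧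
    (b j = 0 → |(∑ k, X k j * (y k - (X.mulVec b) k)) / n| ≤ lam)

/-- A main branch of the solution graph: a continuous path `x ↦ (lam x, beta x)`, `x ≥ 0`, of
critical points with `beta 0 = 0` and `lam x → 0` as `x → ∞`. -/
structure IsMainBranch (X : Matrix (Fin n) (Fin p) ℝ) (y : Fin n → ℝ) (γ : ℝ)
    (lam : ℝ → ℝ) (beta : ℝ → Fin p → ℝ) : Prop where
  continuousOn_lam : ContinuousOn lam (Set.Ici 0)
  continuousOn_beta : ContinuousOn beta (Set.Ici 0)
  lam_nonneg : ∀ x, 0 ≤ x → 0 ≤ lam x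
  critical : ∀ x, 0 ≤ x → IsCritical X y γ (lam x) (beta x)
  beta_zero : beta 0 = 0
  tendsto_lam : Tendsto lam atTop (𝓝 0)

/-- `b` is the MC+ estimate at the penalty level `l`: the point `beta x` of a main branch at
`x = inf {x ≥ 0 : lam x ≤ l}`, where the level `l` is first reached. -/
def IsMCPlus (X : Matrix (Fin n) (Fin p) ℝ) (y : Fin n → ℝ) (γ l : ℝ) (b : Fin p → ℝ) : Prop :=
  ∃ (lam : ℝ → ℝ) (beta : ℝ → Fin p → ℝ), IsMainBranch X y γ lam beta ∧
    b = beta (sInf {x : ℝ | 0 ≤ x ∧ lam x ≤ l})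

end Design

/-- `q > 0`, `2 log q ≥ 1` and
`2 log q - 1 - log (2 log q) = (2 / m) {log (p - d choose m) + log (1 / ε)}`. -/
def IsPTilde (p d m : ℕ) (ε q : ℝ) : Prop :=
  0 < q ∧ 1 ≤ 2 * Real.log q ∧
    2 * Real.log q - 1 - Real.log (2 * Real.log q) =
      (2 / (m : ℝ)) * (Real.log ((p - d).choose m) + Real.log (1 / ε))

theorem existsUnique_isPTilde (p d m : ℕ) {ε : ℝ} (h0 : 0 < ε) (h1 : ε ≤ 1) :
    ∃! q, IsPTilde p d m ε q := by
  set R : ℝ := (2 / (m : ℝ)) * (Real.log ((p - d).choose m) + Real.log (1 / ε)) with hR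
  have hR0 : 0 ≤ R := by
    have hc : 0 ≤ Real.log ((p - d).choose m) := Real.log_natCast_nonneg _
    have he : 0 ≤ Real.log (1 / ε) := Real.log_nonneg (by rw [le_div_iff₀ h0]; linarith)
    positivity
  have hmono : ∀ s t : ℝ, 1 ≤ s → s < t → s - 1 - Real.log s < t - 1 - Real.log t := by
    intro s t hs hst
    have hs0 : 0 < s := by linarith
    have ht0 : 0 < t := by linarith
    have h := Real.log_lt_sub_one_of_pos (div_pos ht0 hs0)
      (by rw [ne_eq, div_eq_one_iff_eq hs0.ne']; exact hst.ne')
    rw [Real.log_div ht0.ne' hs0.ne'] at h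
    have h2 : t / s - 1 ≤ t - s := by
      have : t / s - 1 = (t - s) / s := by field_simp
      rw [this]
      exact div_le_self (by linarith) hs
    linarith
  have hcont : ContinuousOn (fun t : ℝ => t - 1 - Real.log t) (Set.Icc 1 (2 * R + 2)) := by
    refine (by fun_prop : Continuous fun t : ℝ => t - 1).continuousOn.sub
      (Real.continuousOn_log.mono fun t ht => ?_)
    have : (0 : ℝ) < t := lt_of_lt_of_le one_pos ht.1
    exact this.ne'
  obtain ⟨t, ht, hft⟩ : R ∈ (fun t : ℝ => t - 1 - Real.log t) '' Set.Icc 1 (2 * R + 2) := by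
    refine intermediate_value_Icc (by linarith) hcont ⟨by simpa using hR0, ?_⟩
    have hp : (0 : ℝ) < R + 1 := by linarith
    have h := Real.log_le_sub_one_of_pos hp
    have h2 := Real.log_le_sub_one_of_pos (two_pos (α := ℝ))
    have h3 : Real.log (2 * R + 2) = Real.log 2 + Real.log (R + 1) := by
      rw [← Real.log_mul two_ne_zero hp.ne']; ring_nf
    show R ≤ 2 * R + 2 - 1 - Real.log (2 * R + 2)
    linarith
  have hq : 2 * Real.log (Real.exp (t / 2)) = t := by rw [Real.log_exp]; ring
  refine ⟨Real.exp (t / 2), ⟨Real.exp_pos _, by rw [hq]; exact ht.1, by rw [hq]; exact hft⟩, ?_⟩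
  rintro q ⟨hq0, hq1, hq2⟩
  have hqt : 2 * Real.log q = t := by
    rcases lt_trichotomy (2 * Real.log q) t with h | h | h
    · have := hmono _ _ hq1 h
      have hft' : t - 1 - Real.log t = R := hft
      linarith
    · exact h
    · have := hmono _ _ ht.1 h
      have hft' : t - 1 - Real.log t = R := hft
      linarith
  rw [← hqt, mul_div_cancel_left₀ _ two_ne_zero, Real.exp_log hq0]

open Classical in
/-- The number `p̃_ε = p̃_{p,d,m,ε}`, the unique solution `q` of `IsPTilde p d m ε q`
for `0 < ε ≤ 1`. -/
noncomputable def pTilde (p d m : ℕ) (ε : ℝ) : ℝ :=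
  if h : ∃ q, IsPTilde p d m ε q then h.choose else 0

theorem isPTilde_pTilde (p d m : ℕ) {ε : ℝ} (h0 : 0 < ε) (h1 : ε ≤ 1) :
    IsPTilde p d m ε (pTilde p d m ε) := by
  have h := (existsUnique_isPTilde p d m h0 h1).exists
  rw [pTilde, dif_pos h]
  exact h.choose_spec

/-- The universal penalty level `σ √((2 / n) log p)`. -/
noncomputable def lamUniv (n p : ℕ) (σ : ℝ) : ℝ :=
  σ * Real.sqrt (2 / n * Real.log p)

end MCPlus

namespace MCPlus

/-! Write O for the support of β, d for the Riesz rank, m = d - |O|, K = c^*/c_*, l for the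
universal level and λ₁ = 2√(c^*) σ √((2/n) log p̃₁). The proof separates a deterministic statement
about the path from three tail bounds.

Deterministic part. The penalty has concavity at most 1/γ, while γ c_* ≥ 2 makes the loss on any d
columns more convex than that. Hence critical points at one level with supports in a common set of
size at most d coincide (`SparseRiesz.critical_unique`). If the oracle coefficients on O are at
least γ max(λ₁, l) and the gradients off O are below l, the oracle is itself critical at every level
in [l, max(λ₁, l)]. So it suffices that |supp ∪ O| ≤ d along the path until l is reached. This
condition is closed; it propagates to the right because the indices able to enter, together with O,
also number at most d (`card_active_le`). At levels up to max(λ₁, l) the path already is the oracle.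
Above it, a violation gives a set A of size exactly d, and `SparseRiesz.rank_bound` forces the noise
in the m-dimensional part of span X_A orthogonal to X_O to be too large. The level need not be
monotone along the path.

Probabilistic part. The noise lengths are chi-squared with m degrees of freedom, and p̃₁ makes the
exponential factor of the tail cancel the number of sets A. Convergence to zero therefore rests on
the polynomial prefactor of the tail (`stdGaussian_real_norm_sq_le`). The same prefactor handles the
oracle errors and the gradients off O, whose thresholds √(2 log N) are equally borderline. -/

theorem exp_sub_sq_div_two_le {x : ℝ} (hx : 0 ≤ x) : Real.exp (x - x ^ 2 / 2) ≤ 1 + x := by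
  rw [← Real.le_log_iff_exp_le (by linarith)]
  refine le_trans ?_ (Real.le_log_one_add_of_nonneg hx)
  rw [le_div_iff₀ (by linarith)]
  nlinarith [pow_nonneg hx 3]

/-- Bounds t - 1 from below, and with it the tail prefactor, once the left side is prescribed by the
equation for p̃. -/
theorem sub_one_sub_log_le {t : ℝ} (ht : 1 ≤ t) : t - 1 - Real.log t ≤ (t - 1) ^ 2 / 2 := by
  have h := exp_sub_sq_div_two_le (x := t - 1) (by linarith)
  rw [← Real.le_log_iff_exp_le (by linarith)] at h
  ring_nf at h ⊢
  linarith

/-! ### Radial Gaussian integrals -/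

section Radial

variable (k : ℕ)

theorem hasDerivAt_radial (r : ℝ) :
    HasDerivAt (fun r : ℝ => r ^ (k + 1) * Real.exp (-(r ^ 2 / 2)))
      (-((r ^ 2 - (k + 1)) * (r ^ k * Real.exp (-(r ^ 2 / 2))))) r := by
  have h1 : HasDerivAt (fun r : ℝ => -(r ^ 2 / 2)) (-r) r := by
    have := ((hasDerivAt_pow 2 r).div_const 2).neg
    refine this.congr_deriv ?_
    norm_num
  have := (hasDerivAt_pow (k + 1) r).mul h1.exp
  refine this.congr_deriv ?_
  push_cast
  ring

theorem tendsto_radial :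
    Tendsto (fun r : ℝ => r ^ (k + 1) * Real.exp (-(r ^ 2 / 2))) atTop (𝓝 0) := by
  have h := (Real.tendsto_pow_mul_exp_neg_atTop_nhds_zero (k + 1))
  refine squeeze_zero' ?_ ?_ h
  · filter_upwards [eventually_ge_atTop 0] with r hr
    positivity
  · filter_upwards [eventually_ge_atTop 2] with r hr
    gcongr
    nlinarith

variable {k}

/-- Beyond s the factor (r² - (k+1)) / (s² - (k+1)) is at least one, and multiplying the integrand
by it gives an exact derivative. -/
theorem integrableOn_radial_tail {s : ℝ} (hs0 : 0 ≤ s) (hs : (k + 1 : ℝ) < s ^ 2) :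
    IntegrableOn (fun r : ℝ => r ^ k * Real.exp (-(r ^ 2 / 2))) (Set.Ioi s) ∧
      ∫ r in Set.Ioi s, r ^ k * Real.exp (-(r ^ 2 / 2)) ≤
        s ^ (k + 1) * Real.exp (-(s ^ 2 / 2)) / (s ^ 2 - (k + 1)) := by
  have hneg : ∀ r ∈ Set.Ioi s, -((r ^ 2 - (k + 1)) * (r ^ k * Real.exp (-(r ^ 2 / 2)))) ≤ 0 := by
    intro r hr
    have hr0 : 0 ≤ r := hs0.trans (le_of_lt hr)
    have : s ^ 2 ≤ r ^ 2 := by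
      have := le_of_lt (Set.mem_Ioi.1 hr)
      gcongr
    have h2 : 0 ≤ r ^ 2 - (k + 1) := by linarith
    have : 0 ≤ (r ^ 2 - (k + 1)) * (r ^ k * Real.exp (-(r ^ 2 / 2))) := by positivity
    linarith
  have hI := (integrableOn_Ioi_deriv_of_nonpos' (a := s)
    (fun r _ => hasDerivAt_radial k r) hneg (tendsto_radial k)).neg
  have hE := integral_Ioi_of_hasDerivAt_of_nonpos' (a := s)
    (fun r _ => hasDerivAt_radial k r) hneg (tendsto_radial k)
  have hpos : 0 < s ^ 2 - (k + 1) := by linarith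
  have hle : ∀ r ∈ Set.Ioi s, r ^ k * Real.exp (-(r ^ 2 / 2)) ≤
      (s ^ 2 - (k + 1))⁻¹ * ((r ^ 2 - (k + 1)) * (r ^ k * Real.exp (-(r ^ 2 / 2)))) := by
    intro r hr
    have hr0 : 0 ≤ r := hs0.trans (le_of_lt hr)
    have h1 : s ^ 2 ≤ r ^ 2 := by
      have := le_of_lt (Set.mem_Ioi.1 hr)
      gcongr
    have h2 : 0 ≤ r ^ k * Real.exp (-(r ^ 2 / 2)) := by positivity
    rw [inv_mul_eq_div, le_div_iff₀ hpos]
    nlinarith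
  have hI' : IntegrableOn (fun r : ℝ => (s ^ 2 - (k + 1))⁻¹ *
      ((r ^ 2 - (k + 1)) * (r ^ k * Real.exp (-(r ^ 2 / 2))))) (Set.Ioi s) := by
    refine Integrable.const_mul ?_ _
    simpa [IntegrableOn, Pi.neg_def] using hI
  have hInt : IntegrableOn (fun r : ℝ => r ^ k * Real.exp (-(r ^ 2 / 2))) (Set.Ioi s) := by
    refine Integrable.mono' hI' (by fun_prop) ?_
    refine (ae_restrict_iff' measurableSet_Ioi).2 (Eventually.of_forall fun r hr => ?_)
    have hr0 : 0 ≤ r := hs0.trans (le_of_lt hr)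
    rw [Real.norm_of_nonneg (by positivity)]
    exact hle r hr
  refine ⟨hInt, (setIntegral_mono_on hInt hI' measurableSet_Ioi hle).trans (le_of_eq ?_)⟩
  rw [integral_const_mul]
  rw [integral_neg] at hE
  rw [neg_eq_iff_eq_neg.1 hE]
  field_simp
  ring

/-- The function r^(k+1) exp(-r²/2) peaks at a = √(k+1). Keeping only the window (a, a+1] yields a
bound of the same shape as the tail, so neither Gamma function nor Stirling estimate is needed. -/
theorem le_integral_radial
    (hint : IntegrableOn (fun r : ℝ => r ^ k * Real.exp (-(r ^ 2 / 2))) (Set.Ioi 0)) :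
    Real.sqrt (k + 1) ^ (k + 1) * Real.exp (-((k + 1) / 2)) * Real.exp (-1) /
        (Real.sqrt (k + 1) + 1) ≤
      ∫ r in Set.Ioi (0 : ℝ), r ^ k * Real.exp (-(r ^ 2 / 2)) := by
  set a := Real.sqrt (k + 1) with ha
  have ha2 : a ^ 2 = k + 1 := Real.sq_sqrt (by positivity)
  have ha0 : 0 < a := Real.sqrt_pos.2 (by positivity)
  have hsub : Set.Ioc a (a + 1) ⊆ Set.Ioi 0 := fun r hr => ha0.trans hr.1
  calc
    _ = ∫ r in Set.Ioc a (a + 1),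
          a ^ (k + 1) * Real.exp (-((k + 1) / 2)) * Real.exp (-1) / (a + 1) := by
        simp
    _ ≤ ∫ r in Set.Ioc a (a + 1), r ^ k * Real.exp (-(r ^ 2 / 2)) := by
        refine setIntegral_mono_on (integrableOn_const (by simp)) (hint.mono_set hsub)
          measurableSet_Ioc ?_
        intro r hr
        obtain ⟨u, rfl⟩ : ∃ u, r = a + u := ⟨r - a, by ring⟩
        have hu0 : 0 < u := by linarith [hr.1]
        have hu1 : u ≤ 1 := by linarith [hr.2]
        have hr0 : 0 < a + u := by linarith
        rw [div_le_iff₀ (by linarith)]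
        -- As a² = k+1, the term a u cancels against the cross term of (a+u)²/2; only exp(-u²) ≥
        -- exp(-1) is lost.
        have h1 : Real.exp (a * u - u ^ 2 / 2) ≤ (1 + u / a) ^ (k + 1) := by
          have h := exp_sub_sq_div_two_le (x := u / a) (by positivity)
          have h2 := pow_le_pow_left₀ (Real.exp_pos _).le h (k + 1)
          rw [← Real.exp_nat_mul] at h2
          refine le_trans (le_of_eq (congrArg _ ?_)) h2
          push_cast
          rw [← ha2]
          field_simp
        have h2 : (a + u) ^ (k + 1) = a ^ (k + 1) * (1 + u / a) ^ (k + 1) := by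
          rw [← mul_pow]; congr 1; field_simp
        have h3 : (a + u) ^ k * Real.exp (-((a + u) ^ 2 / 2)) * (a + u) =
            (a + u) ^ (k + 1) * Real.exp (-((a + u) ^ 2 / 2)) := by ring
        calc _ ≤ a ^ (k + 1) * Real.exp (-((k + 1) / 2)) * Real.exp (-u ^ 2) := by
              have : u ^ 2 ≤ 1 := by nlinarith
              gcongr
          _ = a ^ (k + 1) * Real.exp (a * u - u ^ 2 / 2) * Real.exp (-((a + u) ^ 2 / 2)) := by
              rw [mul_assoc, mul_assoc, ← Real.exp_add, ← Real.exp_add]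
              congr 2
              rw [← ha2]; ring
          _ ≤ a ^ (k + 1) * (1 + u / a) ^ (k + 1) * Real.exp (-((a + u) ^ 2 / 2)) := by gcongr
          _ = (a + u) ^ k * Real.exp (-((a + u) ^ 2 / 2)) * (a + u) := by rw [h3, h2]
          _ ≤ (a + u) ^ k * Real.exp (-((a + u) ^ 2 / 2)) * (a + 1) := by gcongr
    _ ≤ _ := by
        refine setIntegral_mono_set hint ?_ hsub.eventuallyLE
        refine (ae_restrict_iff' measurableSet_Ioi).2 (Eventually.of_forall fun r hr => ?_)
        have : (0 : ℝ) < r := hr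
        simp only [Pi.zero_apply]
        positivity

end Radial

/-! ### Tail of the norm of a standard Gaussian vector -/

section StdGaussian

variable (V : Type*) [NormedAddCommGroup V] [InnerProductSpace ℝ V] [FiniteDimensional ℝ V]
  [MeasurableSpace V] [BorelSpace V]

theorem integrable_exp_neg_norm_sq_div_two :
    Integrable (fun v : V => Real.exp (-(‖v‖ ^ 2 / 2))) := by
  have h := (GaussianFourier.integrable_cexp_neg_mul_sq_norm_add (V := V) (b := (1 / 2 : ℂ))
    (by norm_num) 0 0).norm
  refine h.congr (Eventually.of_forall fun v => ?_)
  simp only [Complex.norm_exp]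
  congr 1
  simp [← Complex.ofReal_pow]
  ring

theorem integral_exp_neg_norm_sq_div_two_pos :
    0 < ∫ v : V, Real.exp (-(‖v‖ ^ 2 / 2)) := by
  rw [integral_pos_iff_support_of_nonneg (fun v => (Real.exp_pos _).le)
    (integrable_exp_neg_norm_sq_div_two V)]
  have : (Function.support fun v : V => Real.exp (-(‖v‖ ^ 2 / 2))) = Set.univ := by
    ext v; simp [Real.exp_ne_zero]
  rw [this]
  exact isOpen_univ.measure_pos _ Set.univ_nonempty

/-- Both sides have the same characteristic function. The normalizing constant stays an integral,
since only a ratio of radial integrals is needed. -/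
theorem stdGaussian_eq_withDensity :
    stdGaussian V = volume.withDensity fun v : V => ENNReal.ofReal
      ((∫ v : V, Real.exp (-(‖v‖ ^ 2 / 2)))⁻¹ * Real.exp (-(‖v‖ ^ 2 / 2))) := by
  set Z := ∫ v : V, Real.exp (-(‖v‖ ^ 2 / 2)) with hZ
  have hZ0 : 0 < Z := integral_exp_neg_norm_sq_div_two_pos V
  have hf : Measurable fun v : V => Z⁻¹ * Real.exp (-(‖v‖ ^ 2 / 2)) := by fun_prop
  have hint : Integrable (fun v : V => Z⁻¹ * Real.exp (-(‖v‖ ^ 2 / 2))) :=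
    (integrable_exp_neg_norm_sq_div_two V).const_mul _
  have : IsFiniteMeasure (volume.withDensity fun v : V => ENNReal.ofReal
      (Z⁻¹ * Real.exp (-(‖v‖ ^ 2 / 2)))) :=
    isFiniteMeasure_withDensity_ofReal hint.2
  apply Measure.ext_of_charFun
  ext t
  rw [charFun_stdGaussian, charFun_apply]
  have hd : (fun v : V => ENNReal.ofReal (Z⁻¹ * Real.exp (-(‖v‖ ^ 2 / 2)))) =
      fun v => ((Real.toNNReal (Z⁻¹ * Real.exp (-(‖v‖ ^ 2 / 2))) : NNReal) : ENNReal) := rfl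
  rw [hd, integral_withDensity_eq_integral_smul (by fun_prop)]
  have hb : 0 < (1 / 2 : ℂ).re := by norm_num
  have hC := GaussianFourier.integral_cexp_neg_mul_sq_norm_add (V := V) hb Complex.I t
  have hN := GaussianFourier.integral_cexp_neg_mul_sq_norm (V := V) hb
  have hZc : (Z : ℂ) = ∫ v : V, Complex.exp (-(1 / 2 : ℂ) * ‖v‖ ^ 2) := by
    rw [hZ, ← integral_complex_ofReal]
    congr 1
    ext v
    push_cast
    congr 1
    ring
  have hrw : ∀ v : V, (Real.toNNReal (Z⁻¹ * Real.exp (-(‖v‖ ^ 2 / 2)))) •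
      Complex.exp (inner ℝ v t * Complex.I) =
      (Z : ℂ)⁻¹ * Complex.exp (-(1 / 2 : ℂ) * ‖v‖ ^ 2 + Complex.I * inner ℝ t v) := by
    intro v
    rw [NNReal.smul_def, Real.coe_toNNReal _ (by positivity), Complex.real_smul]
    push_cast
    rw [mul_assoc, ← Complex.exp_add, real_inner_comm]
    congr 2
    ring
  simp_rw [hrw]
  rw [integral_const_mul, hC, ← hN, ← hZc, ← mul_assoc,
    inv_mul_cancel₀ (by exact_mod_cast hZ0.ne'), one_mul]
  congr 1
  rw [Complex.I_sq]
  ring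

/-- In polar coordinates the volume of the unit ball cancels, leaving the quotient of the two radial
integrals. -/
theorem stdGaussian_real_le_norm [Nontrivial V] {s : ℝ} (hs0 : 0 ≤ s)
    (hs : (Module.finrank ℝ V : ℝ) < s ^ 2) :
    (stdGaussian V).real {x | s ≤ ‖x‖} ≤
      s ^ (Module.finrank ℝ V) * Real.exp (-(s ^ 2 / 2)) / (s ^ 2 - Module.finrank ℝ V) /
      (Real.sqrt (Module.finrank ℝ V) ^ (Module.finrank ℝ V) *
        Real.exp (-(Module.finrank ℝ V / 2)) * Real.exp (-1) /
        (Real.sqrt (Module.finrank ℝ V) + 1)) := by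
  obtain ⟨k, hk⟩ : ∃ k, Module.finrank ℝ V = k + 1 :=
    ⟨Module.finrank ℝ V - 1, (Nat.succ_pred_eq_of_pos Module.finrank_pos).symm⟩
  set Z := ∫ v : V, Real.exp (-(‖v‖ ^ 2 / 2)) with hZ
  have hZ0 : 0 < Z := integral_exp_neg_norm_sq_div_two_pos V
  have hint := integrable_exp_neg_norm_sq_div_two V
  have hmeas : MeasurableSet {x : V | s ≤ ‖x‖} := measurableSet_le measurable_const measurable_norm
  have h1 : (stdGaussian V).real {x | s ≤ ‖x‖} =
      Z⁻¹ * ∫ v : V, (Set.Ici s).indicator (fun r => Real.exp (-(r ^ 2 / 2))) ‖v‖ := by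
    rw [stdGaussian_eq_withDensity, Measure.real, withDensity_apply _ hmeas,
      ← ofReal_integral_eq_lintegral_ofReal (hint.const_mul _).integrableOn
        (Eventually.of_forall fun v => by positivity),
      ENNReal.toReal_ofReal (integral_nonneg fun v => by positivity), integral_const_mul,
      ← integral_indicator hmeas]
    rfl
  have h2 := integral_fun_norm_addHaar (volume : Measure V)
    ((Set.Ici s).indicator (fun r => Real.exp (-(r ^ 2 / 2))))
  have h3 := integral_fun_norm_addHaar (volume : Measure V) (fun r => Real.exp (-(r ^ 2 / 2)))
  have h4 := (integrable_fun_norm_addHaar (volume : Measure V)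
    (f := fun r => Real.exp (-(r ^ 2 / 2)))).1 hint
  rw [hk, Nat.add_sub_cancel] at h2 h3 h4
  simp only [smul_eq_mul] at h2 h3 h4
  set c := volume.real (Metric.ball (0 : V) 1) with hc
  have hc0 : 0 < c := by
    rw [hc, Measure.real]
    exact ENNReal.toReal_pos (Metric.measure_ball_pos _ _ one_pos).ne' measure_ball_lt_top.ne
  rw [hk] at hs ⊢
  push_cast at hs ⊢
  have hD := le_integral_radial h4
  obtain ⟨-, hN⟩ := integrableOn_radial_tail hs0 hs
  have h5 : ∫ y in Set.Ioi (0 : ℝ), y ^ k *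
      (Set.Ici s).indicator (fun r => Real.exp (-(r ^ 2 / 2))) y =
      ∫ y in Set.Ioi s, y ^ k * Real.exp (-(y ^ 2 / 2)) := by
    have e : ∀ y : ℝ, y ^ k * (Set.Ici s).indicator (fun r => Real.exp (-(r ^ 2 / 2))) y =
        (Set.Ici s).indicator (fun y => y ^ k * Real.exp (-(y ^ 2 / 2))) y := by
      intro y; by_cases hy : y ∈ Set.Ici s <;> simp [hy]
    have hs1 : 0 < s := by
      rcases hs0.eq_or_lt with h | h
      · rw [← h] at hs; norm_num at hs; linarith [(Nat.cast_nonneg k : (0 : ℝ) ≤ k)]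
      · exact h
    simp_rw [e]
    rw [setIntegral_indicator measurableSet_Ici, ← integral_Ici_eq_integral_Ioi]
    congr 2
    ext y
    simp only [Set.mem_inter_iff, Set.mem_Ioi, Set.mem_Ici]
    exact ⟨fun h => h.2, fun h => ⟨hs1.trans_le h, h⟩⟩
  rw [h5] at h2
  rw [h1, h2, hZ, h3]
  simp only [nsmul_eq_mul]
  set D := ∫ r in Set.Ioi (0 : ℝ), r ^ k * Real.exp (-(r ^ 2 / 2))
  set N := ∫ r in Set.Ioi s, r ^ k * Real.exp (-(r ^ 2 / 2))
  have hD0 : 0 < Real.sqrt (k + 1) ^ (k + 1) * Real.exp (-((k + 1) / 2)) * Real.exp (-1) /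
        (Real.sqrt (k + 1) + 1) := by positivity
  have hN0 : 0 ≤ N := by
    refine setIntegral_nonneg measurableSet_Ioi fun r hr => ?_
    have : 0 ≤ r := hs0.trans (le_of_lt hr)
    positivity
  have hDp : 0 < D := hD0.trans_le hD
  have : (((k + 1 : ℕ) : ℝ) * (c * D))⁻¹ * (((k + 1 : ℕ) : ℝ) * (c * N)) = N / D := by
    have : ((k + 1 : ℕ) : ℝ) ≠ 0 := by positivity
    field_simp
  rw [this]
  have : 0 ≤ s ^ (k + 1) * Real.exp (-(s ^ 2 / 2)) / (s ^ 2 - (k + 1)) := hN0.trans hN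
  gcongr

/-- The substitution s² = m t. The factor 1/(√m (t - 1)) is the point: the exponential alone would
leave a union bound of constant order. -/
theorem stdGaussian_real_norm_sq_le [Nontrivial V] {t : ℝ} (ht : 1 < t) :
    (stdGaussian V).real {x | Module.finrank ℝ V * t ≤ ‖x‖ ^ 2} ≤
      2 * Real.exp 1 / (Real.sqrt (Module.finrank ℝ V) * (t - 1)) *
        Real.exp (-(Module.finrank ℝ V / 2 * (t - 1 - Real.log t))) := by
  have hm1 : 1 ≤ Module.finrank ℝ V := Module.finrank_pos
  have h := stdGaussian_real_le_norm V (s := Real.sqrt (Module.finrank ℝ V * t))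
    (Real.sqrt_nonneg _)
  set m := Module.finrank ℝ V
  have hm1' : (1 : ℝ) ≤ m := by exact_mod_cast hm1
  have hset : {x : V | (m : ℝ) * t ≤ ‖x‖ ^ 2} = {x : V | Real.sqrt (m * t) ≤ ‖x‖} := by
    ext x
    exact (Real.sqrt_le_left (norm_nonneg x)).symm
  rw [hset]
  have hs2 : Real.sqrt (m * t) ^ 2 = m * t := Real.sq_sqrt (by positivity)
  rw [hs2] at h
  refine (h (by nlinarith)).trans ?_
  have hb : Real.sqrt (m * t) = Real.sqrt m * Real.exp (Real.log t / 2) := by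
    rw [Real.sqrt_mul (by positivity), Real.exp_half, Real.exp_log (by linarith)]
  have hbp : Real.sqrt (m * t) ^ m = Real.sqrt m ^ m * Real.exp (m / 2 * Real.log t) := by
    rw [hb, mul_pow, ← Real.exp_nat_mul]
    congr 2
    ring
  have hsm : 1 ≤ Real.sqrt m := Real.one_le_sqrt.2 hm1'
  have hsm2 : Real.sqrt m ^ 2 = m := Real.sq_sqrt (by positivity)
  have ht1 : 0 < t - 1 := by linarith
  have hexp : Real.exp (m / 2 * Real.log t) * Real.exp (-(m * t / 2)) =
      Real.exp (-((m : ℝ) / 2 * (t - 1 - Real.log t))) * Real.exp (-(m / 2)) := by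
    rw [← Real.exp_add, ← Real.exp_add]; congr 1; ring
  rw [hbp, mul_assoc, hexp]
  have hsp : 0 < Real.sqrt m ^ m := by positivity
  calc _ = Real.exp (-((m : ℝ) / 2 * (t - 1 - Real.log t))) * (Real.sqrt m + 1) /
        (Real.exp (-1) * (m * (t - 1))) := by
        have : (m : ℝ) * t - m = m * (t - 1) := by ring
        rw [this]
        field_simp
    _ = (Real.sqrt m + 1) * Real.exp 1 / (Real.sqrt m ^ 2 * (t - 1)) *
        Real.exp (-((m : ℝ) / 2 * (t - 1 - Real.log t))) := by
        rw [hsm2, Real.exp_neg 1]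
        field_simp
    _ ≤ (Real.sqrt m + Real.sqrt m) * Real.exp 1 / (Real.sqrt m ^ 2 * (t - 1)) *
        Real.exp (-((m : ℝ) / 2 * (t - 1 - Real.log t))) := by gcongr
    _ = _ := by field_simp; ring

end StdGaussian


/-- An upper bound for the probability that a chi-squared variable with `m` degrees of freedom
is at least `m t`. -/
noncomputable def chiTail (m : ℕ) (t : ℝ) : ℝ :=
  2 * Real.exp 1 / (Real.sqrt m * (t - 1)) * Real.exp (-(m / 2 * (t - 1 - Real.log t)))

theorem chiTail_nonneg (m : ℕ) {t : ℝ} (ht : 1 < t) : 0 ≤ chiTail m t := by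
  have : 0 < t - 1 := by linarith
  unfold chiTail
  positivity

/-! ### Projections of the noise -/

section Noise

variable {n : ℕ} {σ : ℝ}

/-- The law `N(0, σ² I_n)`. -/
noncomputable def noiseLaw (n : ℕ) (σ : ℝ) : Measure (Fin n → ℝ) :=
  Measure.pi fun _ : Fin n => gaussianReal 0 (Real.toNNReal (σ ^ 2))

instance : IsProbabilityMeasure (noiseLaw n σ) := by
  unfold noiseLaw; infer_instance

theorem charFun_noiseLaw (t : EuclideanSpace ℝ (Fin n)) :
    charFun ((noiseLaw n σ).map (WithLp.toLp 2)) t = Complex.exp (-(σ ^ 2 * ‖t‖ ^ 2 / 2)) := by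
  rw [noiseLaw]
  simp_rw [charFun_pi, charFun_gaussianReal, ← Complex.exp_sum, ← Complex.ofReal_pow,
    EuclideanSpace.real_norm_sq_eq]
  congr 1
  rw [← Finset.sum_congr rfl fun i _ => rfl]
  push_cast [Real.coe_toNNReal _ (sq_nonneg σ)]
  rw [Finset.mul_sum, Finset.sum_div, ← Finset.sum_neg_distrib]
  refine Finset.sum_congr rfl fun i _ => ?_
  ring

/-- The projection is adjoint to the inclusion of W, so the characteristic function at t is that of
the noise at t/σ. -/
theorem map_proj_noiseLaw (hσ : 0 < σ) (W : Submodule ℝ (EuclideanSpace ℝ (Fin n))) :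
    (noiseLaw n σ).map (fun e => σ⁻¹ • W.orthogonalProjectionOnto (WithLp.toLp 2 e)) =
      stdGaussian W := by
  have hL : Measurable fun x : EuclideanSpace ℝ (Fin n) => σ⁻¹ • W.orthogonalProjectionOnto x :=
    (W.orthogonalProjectionOnto.continuous.const_smul σ⁻¹).measurable
  have h1 : (noiseLaw n σ).map (fun e => σ⁻¹ • W.orthogonalProjectionOnto (WithLp.toLp 2 e)) =
      ((noiseLaw n σ).map (WithLp.toLp 2)).map
        (fun x : EuclideanSpace ℝ (Fin n) => σ⁻¹ • W.orthogonalProjectionOnto x) := by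
    rw [Measure.map_map hL (by fun_prop)]
    rfl
  rw [h1]
  have : IsProbabilityMeasure ((noiseLaw n σ).map (WithLp.toLp 2)) :=
    Measure.isProbabilityMeasure_map (by fun_prop)
  have : IsProbabilityMeasure (((noiseLaw n σ).map (WithLp.toLp 2)).map
        (fun x : EuclideanSpace ℝ (Fin n) => σ⁻¹ • W.orthogonalProjectionOnto x)) :=
    Measure.isProbabilityMeasure_map hL.aemeasurable
  apply Measure.ext_of_charFun
  ext t
  rw [charFun_stdGaussian, charFun_apply, integral_map hL.aemeasurable (by fun_prop)]
  have h2 : ∀ x : EuclideanSpace ℝ (Fin n),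
      inner ℝ (σ⁻¹ • W.orthogonalProjectionOnto x) t = inner ℝ x (σ⁻¹ • (t : EuclideanSpace ℝ (Fin n))) := by
    intro x
    rw [real_inner_smul_left, real_inner_smul_right,
      Submodule.inner_orthogonalProjectionOnto_eq_of_mem_right]
  simp_rw [h2]
  rw [← charFun_apply, charFun_noiseLaw, norm_smul, Submodule.coe_norm]
  congr 1
  rw [norm_inv, Real.norm_of_nonneg hσ.le]
  have : (σ : ℂ) ≠ 0 := by exact_mod_cast hσ.ne'
  push_cast
  field_simp

theorem noiseLaw_proj_le (hσ : 0 < σ) (W : Submodule ℝ (EuclideanSpace ℝ (Fin n)))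
    (hW : 0 < Module.finrank ℝ W) {t : ℝ} (ht : 1 < t) :
    noiseLaw n σ {e | σ ^ 2 * (Module.finrank ℝ W * t) ≤
        ‖W.orthogonalProjectionOnto (WithLp.toLp 2 e)‖ ^ 2} ≤
      ENNReal.ofReal (chiTail (Module.finrank ℝ W) t) := by
  have : Nontrivial W := Module.nontrivial_of_finrank_pos hW
  have h := stdGaussian_real_norm_sq_le W ht
  rw [← map_proj_noiseLaw hσ W, map_measureReal_apply
    (by exact ((W.orthogonalProjectionOnto.continuous.comp (by fun_prop)).const_smul σ⁻¹).measurable)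
    (measurableSet_le measurable_const (by fun_prop))] at h
  rw [← ofReal_measureReal]
  refine ENNReal.ofReal_le_ofReal (le_trans (le_of_eq ?_) h)
  congr 1
  ext e
  simp only [Set.mem_ofPred_eq, Set.mem_preimage]
  rw [norm_smul, mul_pow, norm_inv, Real.norm_of_nonneg hσ.le, inv_pow, inv_mul_eq_div,
    le_div_iff₀ (by positivity), mul_comm]

/-- Only the component of the noise along a matters, which has one degree of freedom. -/
theorem noiseLaw_inner_le (hσ : 0 < σ) (a : EuclideanSpace ℝ (Fin n)) {t r : ℝ} (ht : 1 < t)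
    (hr : 0 < r) (har : σ * ‖a‖ * Real.sqrt t ≤ r) :
    noiseLaw n σ {e | r ≤ |inner ℝ a (WithLp.toLp 2 e)|} ≤ ENNReal.ofReal (chiTail 1 t) := by
  rcases eq_or_ne a 0 with rfl | ha
  · have : {e : Fin n → ℝ | r ≤ |inner ℝ (0 : EuclideanSpace ℝ (Fin n)) (WithLp.toLp 2 e)|} = ∅ := by
      ext e; simp [hr]
    rw [this]; simp
  · have hf : Module.finrank ℝ (Submodule.span ℝ {a}) = 1 := finrank_span_singleton ha
    have h := noiseLaw_proj_le hσ (Submodule.span ℝ {a}) (by rw [hf]; exact one_pos) ht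
    rw [hf] at h
    refine (measure_mono ?_).trans h
    intro e he
    simp only [Set.mem_ofPred_eq] at he ⊢
    set x : EuclideanSpace ℝ (Fin n) := WithLp.toLp 2 e
    set q := (Submodule.span ℝ {a}).orthogonalProjectionOnto x with hq
    have h1 : inner ℝ a x = inner ℝ a (q : EuclideanSpace ℝ (Fin n)) := by
      have := Submodule.inner_orthogonalProjectionOnto_eq_of_mem_left (K := Submodule.span ℝ {a})
        ⟨a, Submodule.mem_span_singleton_self a⟩ x
      rw [← this]
      rfl
    have h2 : r ≤ ‖a‖ * ‖q‖ := he.trans (by rw [h1]; exact abs_real_inner_le_norm _ _)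
    have ha0 : 0 < ‖a‖ := norm_pos_iff.2 ha
    have h3 : σ * Real.sqrt t ≤ ‖q‖ := by
      have : ‖a‖ * (σ * Real.sqrt t) ≤ ‖a‖ * ‖q‖ := by linarith
      exact le_of_mul_le_mul_left this ha0
    have h4 := pow_le_pow_left₀ (by positivity) h3 2
    rw [mul_pow, Real.sq_sqrt (by linarith)] at h4
    simpa using h4

end Noise

/-! ### Union bounds at borderline thresholds -/

theorem tendsto_mul_chiTail_one :
    Tendsto (fun N : ℕ => (N : ℝ) * chiTail 1 (2 * Real.log N)) atTop (𝓝 0) := by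
  have hlog : Tendsto (fun N : ℕ => 2 * Real.log (N : ℝ)) atTop atTop :=
    (Real.tendsto_log_atTop.comp tendsto_natCast_atTop_atTop).const_mul_atTop two_pos
  have hlim : Tendsto (fun N : ℕ => 4 * Real.exp (3 / 2) / Real.sqrt (2 * Real.log (N : ℝ)))
      atTop (𝓝 0) :=
    (Real.tendsto_sqrt_atTop.comp hlog).const_div_atTop _
  refine squeeze_zero' ?_ ?_ hlim
  · filter_upwards [hlog.eventually_gt_atTop 1] with N hN
    exact mul_nonneg (Nat.cast_nonneg _) (chiTail_nonneg 1 hN)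
  · filter_upwards [hlog.eventually_ge_atTop 2, eventually_gt_atTop 0] with N hN hN0
    set t := 2 * Real.log (N : ℝ) with ht
    have hN' : (N : ℝ) = Real.exp (t / 2) := by
      rw [ht, mul_div_cancel_left₀ _ two_ne_zero, Real.exp_log (by exact_mod_cast hN0)]
    have hs : Real.exp (Real.log t / 2) = Real.sqrt t := by
      rw [Real.exp_half, Real.exp_log (by linarith)]
    have hst : Real.sqrt t ^ 2 = t := Real.sq_sqrt (by linarith)
    have hs0 : 0 < Real.sqrt t := Real.sqrt_pos.2 (by linarith)
    have h1 : (N : ℝ) * chiTail 1 t =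
        2 * (Real.exp 1 * Real.exp (1 / 2)) * Real.sqrt t / (t - 1) := by
      have : Real.exp (-(((1 : ℕ) : ℝ) / 2 * (t - 1 - Real.log t))) =
          Real.exp (-(t / 2)) * (Real.exp (1 / 2) * Real.exp (Real.log t / 2)) := by
        rw [← Real.exp_add, ← Real.exp_add]; congr 1; push_cast; ring
      rw [chiTail, this, hN', hs, Real.exp_neg (t / 2)]
      have := (Real.exp_pos (t / 2)).ne'
      simp only [Nat.cast_one, Real.sqrt_one, one_mul]
      field_simp
    rw [h1, ← Real.exp_add, div_le_div_iff₀ (by linarith) hs0]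
    have he : (0 : ℝ) < Real.exp (3 / 2) := Real.exp_pos _
    norm_num
    have h3 : 2 * Real.exp (3 / 2) * Real.sqrt t * Real.sqrt t = 2 * Real.exp (3 / 2) * t := by
      rw [mul_assoc, ← sq, hst]
    rw [h3]
    nlinarith

/-- The equation for t cancels the binomial exactly. Since m < N, the binomial is at least m + 1,
whence √m (t - 1) ≥ 2 √(log (m + 1)). For m = N one would have t = 1 and no control of the
prefactor. -/
theorem choose_mul_chiTail_le {N m : ℕ} (hm : 0 < m) (hmN : m < N) {t : ℝ} (ht : 1 ≤ t)
    (h : t - 1 - Real.log t = 2 / (m : ℝ) * Real.log (N.choose m)) :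
    1 < t ∧ (N.choose m : ℝ) * chiTail m t ≤ Real.exp 1 / Real.sqrt (Real.log (m + 1)) := by
  have hm' : (0 : ℝ) < m := by exact_mod_cast hm
  have hch : (m + 1 : ℝ) ≤ N.choose m := by
    have : (m + 1).choose m ≤ N.choose m := Nat.choose_le_choose m hmN
    rw [Nat.choose_succ_self_right] at this
    exact_mod_cast this
  have hch0 : (0 : ℝ) < N.choose m := by linarith
  have hl : Real.log (m + 1) ≤ Real.log (N.choose m) := Real.log_le_log (by linarith) hch
  have hl0 : 0 < Real.log (m + 1) := Real.log_pos (by linarith)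
  have h1 := sub_one_sub_log_le ht
  rw [h] at h1
  have h2 : 4 * Real.log (m + 1) ≤ m * (t - 1) ^ 2 := by
    have h3 : 2 / (m : ℝ) * Real.log (m + 1) ≤ (t - 1) ^ 2 / 2 := by
      refine le_trans ?_ h1
      gcongr
    rw [div_mul_eq_mul_div, div_le_div_iff₀ hm' two_pos] at h3
    linarith
  have ht1 : 1 < t := by
    rcases ht.eq_or_lt with h0 | h0
    · rw [← h0] at h2; norm_num at h2; linarith
    · exact h0
  refine ⟨ht1, ?_⟩
  have h4 : 2 * Real.sqrt (Real.log (m + 1)) ≤ Real.sqrt m * (t - 1) := by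
    refine abs_le_of_sq_le_sq' ?_ (by have := Real.sqrt_nonneg (m : ℝ); nlinarith) |>.2
    rw [mul_pow, mul_pow, Real.sq_sqrt hl0.le, Real.sq_sqrt hm'.le]
    linarith
  have h5 : Real.exp (-((m : ℝ) / 2 * (t - 1 - Real.log t))) = (N.choose m : ℝ)⁻¹ := by
    rw [h, ← Real.exp_log (inv_pos.2 hch0), Real.log_inv]
    congr 1
    field_simp
  have h6 : 0 < Real.sqrt (Real.log (m + 1)) := Real.sqrt_pos.2 hl0
  calc (N.choose m : ℝ) * chiTail m t = 2 * Real.exp 1 / (Real.sqrt m * (t - 1)) := by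
        rw [chiTail, h5]; field_simp
    _ ≤ 2 * Real.exp 1 / (2 * Real.sqrt (Real.log (m + 1))) := by gcongr
    _ = _ := by rw [mul_div_mul_left _ _ two_ne_zero]


/-! ### Quadratic forms with spectrum in [c_*, c^*] -/

section Operator

variable {V : Type*} [NormedAddCommGroup V] [InnerProductSpace ℝ V]

open scoped RealInnerProductSpace

/-- In an eigenbasis each inequality follows from cl ≤ μ ≤ cu termwise. Positivity turns the lower
bound on ‖T u‖ into one on the eigenvalues themselves. -/
theorem bounds_of_isSymmetric [FiniteDimensional ℝ V] {T : V →ₗ[ℝ] V} (hT : T.IsSymmetric)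
    {cl cu : ℝ} (hcl : 0 < cl) (hpos : ∀ u, 0 ≤ ⟪T u, u⟫)
    (hlow : ∀ u : V, ‖u‖ = 1 → cl ≤ ‖T u‖) (hup : ∀ μ : ℝ, Module.End.HasEigenvalue T μ → μ ≤ cu)
    (u : V) :
    cl * ‖u‖ ^ 2 ≤ ⟪T u, u⟫ ∧ ‖T u‖ ^ 2 ≤ cu * ⟪T u, u⟫ ∧ cl * ⟪T u, u⟫ ≤ ‖T u‖ ^ 2 := by
  set e := hT.eigenvectorBasis rfl with he
  set μ := hT.eigenvalues rfl with hμ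
  have hTe : ∀ i, T (e i) = μ i • e i := fun i => by
    exact hT.apply_eigenvectorBasis rfl i
  have hμ0 : ∀ i, 0 ≤ μ i := fun i => by
    have h := hpos (e i)
    rw [hTe, real_inner_smul_left, real_inner_self_eq_norm_sq, e.orthonormal.1 i] at h
    simpa using h
  have hμl : ∀ i, cl ≤ μ i := fun i => by
    have h := hlow (e i) (e.orthonormal.1 i)
    rw [hTe, norm_smul, e.orthonormal.1 i, mul_one, Real.norm_of_nonneg (hμ0 i)] at h
    exact h
  have hμu : ∀ i, μ i ≤ cu := fun i => hup _ (by
    simpa using hT.hasEigenvalue_eigenvalues rfl i)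
  have hcoef : ∀ i, ⟪e i, T u⟫ = μ i * ⟪e i, u⟫ := fun i => by
    rw [← hT, hTe, real_inner_smul_left]
  have h1 : ‖u‖ ^ 2 = ∑ i, ⟪e i, u⟫ ^ 2 := (e.sum_sq_inner_right u).symm
  have h2 : ‖T u‖ ^ 2 = ∑ i, μ i ^ 2 * ⟪e i, u⟫ ^ 2 := by
    rw [← e.sum_sq_inner_right (T u)]
    exact Finset.sum_congr rfl fun i _ => by rw [hcoef, mul_pow]
  have h3 : ⟪T u, u⟫ = ∑ i, μ i * ⟪e i, u⟫ ^ 2 := by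
    rw [← e.sum_inner_mul_inner (T u) u]
    exact Finset.sum_congr rfl fun i _ => by rw [real_inner_comm, hcoef]; ring
  rw [h1, h2, h3, Finset.mul_sum, Finset.mul_sum, Finset.mul_sum]
  refine ⟨Finset.sum_le_sum fun i _ => ?_, Finset.sum_le_sum fun i _ => ?_,
    Finset.sum_le_sum fun i _ => ?_⟩
  · exact mul_le_mul_of_nonneg_right (hμl i) (sq_nonneg _)
  · rw [← mul_assoc]
    refine mul_le_mul_of_nonneg_right ?_ (sq_nonneg _)
    nlinarith [hμu i, hμ0 i]
  · rw [← mul_assoc]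
    refine mul_le_mul_of_nonneg_right ?_ (sq_nonneg _)
    nlinarith [hμl i, hμ0 i]

/-- A lower bound for `⟪f, T f⟫` when `T (f - h)` is the sum of two orthogonal vectors. -/
theorem quadratic_form_lower_bound [FiniteDimensional ℝ V] {T : V →ₗ[ℝ] V} (hT : T.IsSymmetric)
    {cl cu δ : ℝ} (hcl : 0 < cl) (hcu : 0 < cu) (hδ0 : 0 ≤ δ) (hδ2 : δ ≤ 2)
    (hb : ∀ u, cl * ‖u‖ ^ 2 ≤ ⟪T u, u⟫ ∧ ‖T u‖ ^ 2 ≤ cu * ⟪T u, u⟫ ∧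
      cl * ⟪T u, u⟫ ≤ ‖T u‖ ^ 2)
    {f h g₁ g₂ : V} (hg : ⟪g₁, g₂⟫ = 0) (hf : T (f - h) = g₁ + g₂) :
    3 / 4 * ‖g₁‖ ^ 2 - (cu / cl - 1) / 3 * ‖g₂‖ ^ 2 + cu * (1 + δ) * ⟪h, g₁⟫ +
      2 * cu * δ * ⟪h, g₂⟫ + cu * cl * (δ * (2 - δ)) * ‖h‖ ^ 2 ≤ cu * ⟪T f, f⟫ := by
  have hinj : Function.Injective T := by
    rw [← LinearMap.ker_eq_bot, LinearMap.ker_eq_bot']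
    intro v hv
    have := (hb v).1
    rw [hv, inner_zero_left] at this
    have h2 : ‖v‖ ^ 2 ≤ 0 := by nlinarith
    exact norm_eq_zero.1 (pow_eq_zero_iff two_ne_zero |>.1 (le_antisymm h2 (sq_nonneg _)))
  obtain ⟨u, hu⟩ := (LinearMap.injective_iff_surjective.1 hinj) g₁
  obtain ⟨v, hv⟩ : ∃ v, f = u + v + h := ⟨f - h - u, by abel⟩
  have hv2 : T v = g₂ := by
    have : f - h = u + v := by rw [hv]; abel
    rw [this, map_add, hu] at hf
    exact add_left_cancel hf
  have hpos : ∀ w, 0 ≤ ⟪T w, w⟫ := fun w => (by positivity : 0 ≤ cl * ‖w‖ ^ 2).trans (hb w).1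
  have e1 : ⟪g₁, v⟫ = ⟪g₂, u⟫ := by
    rw [← hu, ← hv2, hT, real_inner_comm]
  have e2 : ⟪T h, u⟫ = ⟪g₁, h⟫ := by rw [hT, hu, real_inner_comm]
  have e3 : ⟪T h, v⟫ = ⟪g₂, h⟫ := by rw [hT, hv2, real_inner_comm]
  -- With Q(x) = ⟪T x, x⟫, expansion gives Q(u+v+h) = Q(u/2 + v + (1-δ)h) + ¾ Q(u + ⅔v) - ⅓ Q(v) +
  -- δ(2-δ) Q(h) + (1+δ)⟪h, g₁⟫ + 2δ⟪h, g₂⟫. The factor ⅔ absorbs the cross term of u and v; the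
  -- four Q-terms are bounded by `c1` to `c4`.
  have c1 := hpos ((1 / 2 : ℝ) • u + v + (1 - δ) • h)
  have c2 := (hb (u + (2 / 3 : ℝ) • v)).2.1
  have c3 := (hb v).2.2
  have c4 := (hb h).1
  have n1 : ‖T (u + (2 / 3 : ℝ) • v)‖ ^ 2 = ‖g₁‖ ^ 2 + 4 / 9 * ‖g₂‖ ^ 2 := by
    rw [map_add, map_smul, hu, hv2, norm_add_sq_real, real_inner_smul_right, hg, norm_smul,
      mul_pow]
    norm_num
  rw [n1] at c2
  rw [hv2] at c3
  rw [hv]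
  simp only [map_add, map_smul, hu, hv2, inner_add_left, inner_add_right, real_inner_smul_left,
    real_inner_smul_right, e1, e2, e3] at c1 c2 ⊢
  rw [real_inner_comm g₁ h, real_inner_comm g₂ h]
  have c3' : ⟪g₂, v⟫ ≤ ‖g₂‖ ^ 2 / cl := by rw [le_div_iff₀ hcl]; linarith
  have c4' : δ * (2 - δ) * (cl * ‖h‖ ^ 2) ≤ δ * (2 - δ) * ⟪T h, h⟫ :=
    mul_le_mul_of_nonneg_left c4 (mul_nonneg hδ0 (by linarith))
  have hdiv : cu / cl * ‖g₂‖ ^ 2 = cu * (‖g₂‖ ^ 2 / cl) := by ring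
  have c1' := mul_le_mul_of_nonneg_left c1 hcu.le
  have c3'' := mul_le_mul_of_nonneg_left c3' hcu.le
  have c4'' := mul_le_mul_of_nonneg_left c4' hcu.le
  have key : (cu / cl - 1) / 3 * ‖g₂‖ ^ 2 = cu * (‖g₂‖ ^ 2 / cl) / 3 - ‖g₂‖ ^ 2 / 3 := by
    rw [← hdiv]; ring
  rw [key]
  nlinarith

end Operator

/-! ### Scalar inequalities for the penalty -/

section Scalar

/-- The subgradient relation between a coefficient `b` and a gradient coordinate `g`. -/
def IsMCPPair (γ lam b g : ℝ) : Prop :=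
  (b ≠ 0 → g = Real.sign b * mcpDeriv γ lam |b|) ∧ (b = 0 → |g| ≤ lam)

variable {γ lam b g b' g' : ℝ}

theorem mcpDeriv_eq (hγ : 0 < γ) (hl : 0 < lam) (t : ℝ) :
    mcpDeriv γ lam t = max (lam - t / γ) 0 := by
  rw [mcpDeriv, mul_max_of_nonneg _ _ hl.le]
  congr 1
  · field_simp
  · simp

namespace IsMCPPair

theorem add_div_of_pos (h : IsMCPPair γ lam b g) (hγ : 0 < γ) (hl : 0 < lam) (hb : 0 < b) :
    g + b / γ = max lam (b / γ) := by
  rw [h.1 hb.ne', Real.sign_of_pos hb, one_mul, mcpDeriv_eq hγ hl, abs_of_pos hb,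
    ← max_add_add_right]
  simp

theorem add_div_of_neg (h : IsMCPPair γ lam b g) (hγ : 0 < γ) (hl : 0 < lam) (hb : b < 0) :
    g + b / γ = min (-lam) (b / γ) := by
  rw [h.1 hb.ne, Real.sign_of_neg hb, mcpDeriv_eq hγ hl, abs_of_neg hb, neg_one_mul, ← min_neg_neg,
    ← min_add_add_right]
  congr 1
  · ring
  · simp

theorem abs_le (h : IsMCPPair γ lam b g) (hγ : 0 < γ) (hl : 0 < lam) : |g| ≤ lam := by
  rcases lt_trichotomy b 0 with hb | hb | hb
  · have h1 := h.add_div_of_neg hγ hl hb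
    have h2 : b / γ < 0 := div_neg_of_neg_of_pos hb hγ
    rw [_root_.abs_le]
    rcases min_cases (-lam) (b / γ) with ⟨h3, h4⟩ | ⟨h3, h4⟩ <;> constructor <;> linarith
  · exact h.2 hb
  · have h1 := h.add_div_of_pos hγ hl hb
    have h2 : 0 < b / γ := div_pos hb hγ
    rw [_root_.abs_le]
    rcases max_cases lam (b / γ) with ⟨h3, h4⟩ | ⟨h3, h4⟩ <;> constructor <;> linarith

theorem mul_nonneg (h : IsMCPPair γ lam b g) (hγ : 0 < γ) (hl : 0 < lam) : 0 ≤ b * g := by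
  rcases lt_trichotomy b 0 with hb | hb | hb
  · have h1 := h.add_div_of_neg hγ hl hb
    have h2 := min_le_right (-lam) (b / γ)
    exact mul_nonneg_of_nonpos_of_nonpos hb.le (by linarith)
  · simp [hb]
  · have h1 := h.add_div_of_pos hγ hl hb
    have h2 := le_max_right lam (b / γ)
    exact _root_.mul_nonneg hb.le (by linarith)

theorem le_abs_add (h : IsMCPPair γ lam b g) (hγ : 0 < γ) (hl : 0 < lam) (hb : b ≠ 0) :
    lam ≤ |g| + |b| / γ := by
  rcases lt_or_gt_of_ne hb with hb | hb
  · have h1 := h.add_div_of_neg hγ hl hb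
    have h2 := min_le_left (-lam) (b / γ)
    rw [abs_of_neg hb, neg_div]
    linarith [neg_le_abs g]
  · have h1 := h.add_div_of_pos hγ hl hb
    have h2 := le_max_left lam (b / γ)
    rw [abs_of_pos hb]
    linarith [le_abs_self g]

theorem min_le_add_div_le_max (h : IsMCPPair γ lam b g) (hγ : 0 < γ) (hl : 0 < lam) :
    -lam ⊓ (b / γ) ≤ g + b / γ ∧ g + b / γ ≤ lam ⊔ (b / γ) := by
  rcases lt_trichotomy b 0 with hb | hb | hb
  · rw [h.add_div_of_neg hγ hl hb]
    exact ⟨le_rfl, (min_le_right _ _).trans (le_max_right _ _)⟩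
  · have := _root_.abs_le.1 (h.2 hb)
    simp only [hb, zero_div, add_zero]
    exact ⟨(min_le_left _ _).trans this.1, this.2.trans (le_max_left _ _)⟩
  · rw [h.add_div_of_pos hγ hl hb]
    exact ⟨(min_le_right _ _).trans (le_max_right _ _), le_rfl⟩

theorem add_div_le_add_div (h : IsMCPPair γ lam b g) (h' : IsMCPPair γ lam b' g') (hγ : 0 < γ)
    (hl : 0 < lam) (hb : b < b') : g + b / γ ≤ g' + b' / γ := by
  have hbγ : b / γ ≤ b' / γ := by gcongr
  rcases lt_or_ge 0 b' with hb' | hb'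
  · rw [h'.add_div_of_pos hγ hl hb']
    exact (h.min_le_add_div_le_max hγ hl).2.trans (max_le_max le_rfl hbγ)
  · rw [h.add_div_of_neg hγ hl (hb.trans_le hb')]
    exact (min_le_min le_rfl hbγ).trans (h'.min_le_add_div_le_max hγ hl).1

/-- At a fixed level g + b/γ is nondecreasing in b: it is b/γ pushed outside (-λ, λ). This is the
bound 1/γ on the concavity of the penalty. -/
theorem neg_sq_div_le (h : IsMCPPair γ lam b g) (h' : IsMCPPair γ lam b' g') (hγ : 0 < γ)
    (hl : 0 < lam) : -((b - b') ^ 2 / γ) ≤ (b - b') * (g - g') := by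
  have key : 0 ≤ (b - b') * ((g + b / γ) - (g' + b' / γ)) := by
    rcases lt_trichotomy b b' with hb | hb | hb
    · exact mul_nonneg_of_nonpos_of_nonpos (by linarith)
        (by linarith [add_div_le_add_div h h' hγ hl hb])
    · simp [hb]
    · exact _root_.mul_nonneg (by linarith) (by linarith [add_div_le_add_div h' h hγ hl hb])
  have : (b - b') * ((g + b / γ) - (g' + b' / γ)) = (b - b') * (g - g') + (b - b') ^ 2 / γ := by
    ring
  linarith

end IsMCPPair

/-- Contribution of an index outside O. In λ² ≤ (|g| + |b|/γ)² the cross term is covered by cu γ ≥ 2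
and the last square by the coefficient of b². -/
theorem three_quarters_sq_le {cl cu δ : ℝ} (hl : 0 ≤ lam) (hγ : 0 < γ) (hδ : 0 ≤ δ)
    (hcu : 2 ≤ cu * γ) (hτ : 1 ≤ cu * cl * (δ * (2 - δ)) * γ ^ 2) (hbg : 0 ≤ b * g)
    (h : lam ≤ |g| + |b| / γ) :
    3 / 4 * lam ^ 2 ≤ 3 / 4 * g ^ 2 + cu * (1 + δ) * (b * g) + cu * cl * (δ * (2 - δ)) * b ^ 2 := by
  set s := |b| / γ with hs
  have hs0 : 0 ≤ s := by positivity
  have hb : |b| = γ * s := by rw [hs]; field_simp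
  have h1 : b * g = γ * s * |g| := by rw [← abs_of_nonneg hbg, abs_mul, hb]
  have h2 : b ^ 2 = γ ^ 2 * s ^ 2 := by rw [← sq_abs, hb]; ring
  have h3 : lam ^ 2 ≤ (|g| + s) ^ 2 := by gcongr
  have h4 : 2 * (s * |g|) ≤ cu * (1 + δ) * (b * g) := by
    rw [h1]
    have h5 : 0 ≤ s * |g| := by positivity
    nlinarith [mul_le_mul_of_nonneg_right hcu h5,
      mul_nonneg (mul_nonneg (by linarith : 0 ≤ cu * γ) hδ) h5]
  have h5 : s ^ 2 ≤ cu * cl * (δ * (2 - δ)) * b ^ 2 := by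
    rw [h2]
    nlinarith [mul_le_mul_of_nonneg_right hτ (sq_nonneg s)]
  have h6 : 0 ≤ s * |g| := by positivity
  rw [← sq_abs g]
  nlinarith [sq_nonneg s]

/-- Contribution of an index in O, by completing the square with x the coefficient error. -/
theorem neg_mul_sq_le {cl c κ x : ℝ} (hc : 7 / 16 * cl ^ 2 ≤ c) (hg : g ^ 2 ≤ lam ^ 2)
    (hκ : 0 ≤ κ) : -((κ + 1 / 7) * lam ^ 2) ≤ -(κ * g ^ 2) + cl / 2 * (x * g) + c * x ^ 2 := by
  have h1 := mul_le_mul_of_nonneg_right hc (sq_nonneg x)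
  have h2 := mul_le_mul_of_nonneg_left hg (by linarith : 0 ≤ κ + 1 / 7)
  have h3 : 0 ≤ (7 * cl * x + 4 * g) ^ 2 / 112 := by positivity
  have h4 : (7 * cl * x + 4 * g) ^ 2 / 112 =
      7 / 16 * cl ^ 2 * x ^ 2 + cl / 2 * (x * g) + 1 / 7 * g ^ 2 := by ring
  linarith

end Scalar


/-! ### Gram operators, uniqueness and the rank bound -/

section Regression

variable {n p : ℕ} (X : Matrix (Fin n) (Fin p) ℝ)

/-- The `j`-th column of the design as a vector of the Euclidean space. -/
noncomputable def col (j : Fin p) : EuclideanSpace ℝ (Fin n) :=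
  WithLp.toLp 2 fun k => X k j

/-- The fitted vector `X b` as a vector of the Euclidean space. -/
noncomputable def fit (b : Fin p → ℝ) : EuclideanSpace ℝ (Fin n) :=
  ∑ j, b j • col X j

/-- The linear span of the columns with indices in `A`. -/
noncomputable def colSpan (A : Finset (Fin p)) : Submodule ℝ (EuclideanSpace ℝ (Fin n)) :=
  Submodule.span ℝ (Set.range fun j : A => col X j)

/-- The gradient coordinate `x_j' (y - X b) / n`. -/
noncomputable def corr (y : Fin n → ℝ) (b : Fin p → ℝ) (j : Fin p) : ℝ :=
  inner ℝ (col X j) (WithLp.toLp 2 y - fit X b) / n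

/-- The Gram matrix of the columns in `A` as an operator. -/
noncomputable def gram (A : Finset (Fin p)) : EuclideanSpace ℝ A →ₗ[ℝ] EuclideanSpace ℝ A :=
  Matrix.toEuclideanLin (subGram X A)

/-- The linear combination of the columns in `A` with coefficients `u`. -/
noncomputable def comb (A : Finset (Fin p)) (u : EuclideanSpace ℝ A) : EuclideanSpace ℝ (Fin n) :=
  ∑ j : A, u j • col X j

variable {X} {A O : Finset (Fin p)} {d : ℕ} {cl cu γ lam : ℝ} {y : Fin n → ℝ} {b b' : Fin p → ℝ}

theorem inner_col_eq_sum (j : Fin p) (v : EuclideanSpace ℝ (Fin n)) :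
    inner ℝ (col X j) v = ∑ k, X k j * v k := by
  simp [col, PiLp.inner_apply, mul_comm]

theorem fit_apply (b : Fin p → ℝ) (k : Fin n) : fit X b k = X.mulVec b k := by
  simp [fit, col, Matrix.mulVec, dotProduct, mul_comm]

theorem toLp_mulVec (b : Fin p → ℝ) : WithLp.toLp 2 (X.mulVec b) = fit X b := by
  ext k
  rw [fit_apply]

theorem fit_sub (b b' : Fin p → ℝ) : fit X (b - b') = fit X b - fit X b' := by
  simp [fit, sub_smul, Finset.sum_sub_distrib]

theorem corr_eq_sum (j : Fin p) :
    (∑ k, X k j * (y k - X.mulVec b k)) / n = corr X y b j := by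
  rw [corr, inner_col_eq_sum]
  simp [fit_apply]

theorem isCritical_iff : IsCritical X y γ lam b ↔ ∀ j, IsMCPPair γ lam (b j) (corr X y b j) := by
  simp only [IsCritical, IsMCPPair, corr_eq_sum]

theorem norm_col_sq (j : Fin p) : ‖col X j‖ ^ 2 = ∑ k, X k j ^ 2 := by
  rw [EuclideanSpace.real_norm_sq_eq]
  rfl

theorem col_mem_colSpan {j : Fin p} (hj : j ∈ A) : col X j ∈ colSpan X A :=
  Submodule.subset_span ⟨⟨j, hj⟩, rfl⟩

theorem colSpan_mono (h : O ⊆ A) : colSpan X O ≤ colSpan X A := by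
  refine Submodule.span_le.2 ?_
  rintro _ ⟨j, rfl⟩
  exact col_mem_colSpan (h j.2)

theorem comb_restrict (hb : ∀ j ∉ A, b j = 0) :
    comb X A (WithLp.toLp 2 fun j : A => b j) = fit X b := by
  simp only [comb, fit]
  rw [Finset.sum_coe_sort A (fun j => b j • col X j)]
  refine Finset.sum_subset (Finset.subset_univ _) fun j _ hj => ?_
  rw [hb j hj, zero_smul]

theorem fit_mem_colSpan (hb : ∀ j ∉ A, b j = 0) : fit X b ∈ colSpan X A := by
  rw [← comb_restrict hb, comb]
  exact Submodule.sum_mem _ fun j _ => Submodule.smul_mem _ _ (col_mem_colSpan j.2)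

theorem exists_comb_eq {v : EuclideanSpace ℝ (Fin n)} (hv : v ∈ colSpan X A) :
    ∃ u, comb X A u = v := by
  obtain ⟨c, hc⟩ := (Submodule.mem_span_range_iff_exists_fun ℝ).1 hv
  exact ⟨WithLp.toLp 2 c, hc⟩

theorem exists_fit_eq {v : EuclideanSpace ℝ (Fin n)} (hv : v ∈ colSpan X A) :
    ∃ b : Fin p → ℝ, (∀ j ∉ A, b j = 0) ∧ fit X b = v := by
  obtain ⟨u, hu⟩ := exists_comb_eq hv
  refine ⟨fun j => if h : j ∈ A then u ⟨j, h⟩ else 0, fun j hj => by simp [hj], ?_⟩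
  rw [← comb_restrict (A := A) (fun j hj => by simp [hj]), ← hu]
  congr 1
  ext j
  simp

theorem gram_apply (u : EuclideanSpace ℝ A) (j : A) :
    gram X A u j = inner ℝ (col X j) (comb X A u) / n := by
  simp only [gram, Matrix.toEuclideanLin, comb, inner_sum, real_inner_smul_right, Finset.sum_div]
  change ∑ i, _ = _
  refine Finset.sum_congr rfl fun i _ => ?_
  rw [inner_col_eq_sum]
  simp only [col, subGram]
  rw [mul_comm]
  exact (mul_div_assoc _ _ _).symm

theorem inner_gram (u v : EuclideanSpace ℝ A) :
    inner ℝ (gram X A u) v = inner ℝ (comb X A u) (comb X A v) / n := by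
  rw [PiLp.inner_apply, comb, comb, ← comb, inner_sum, Finset.sum_div]
  refine Finset.sum_congr rfl fun j _ => ?_
  rw [gram_apply, real_inner_smul_right, real_inner_comm (comb X A u)]
  simp [mul_div_assoc]

theorem gram_isSymmetric : (gram X A).IsSymmetric := fun u v => by
  rw [inner_gram, real_inner_comm, real_inner_comm (gram X A v), inner_gram]

theorem SparseRiesz.gram_bounds (h : SparseRiesz X d cl cu) (hA : A.card ≤ d)
    (u : EuclideanSpace ℝ A) :
    cl * ‖u‖ ^ 2 ≤ inner ℝ (gram X A u) u ∧ ‖gram X A u‖ ^ 2 ≤ cu * inner ℝ (gram X A u) u ∧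
      cl * inner ℝ (gram X A u) u ≤ ‖gram X A u‖ ^ 2 := by
  refine bounds_of_isSymmetric gram_isSymmetric h.1 (fun v => ?_) (h.2.2 A hA).1 (h.2.2 A hA).2 u
  rw [inner_gram, real_inner_self_eq_norm_sq]
  positivity

theorem SparseRiesz.norm_fit_sq_ge (h : SparseRiesz X d cl cu) (hA : A.card ≤ d)
    (hb : ∀ j ∉ A, b j = 0) : cl * ∑ j, b j ^ 2 ≤ ‖fit X b‖ ^ 2 / n := by
  have h1 := (h.gram_bounds hA (WithLp.toLp 2 fun j : A => b j)).1
  rw [inner_gram, comb_restrict hb, real_inner_self_eq_norm_sq, EuclideanSpace.real_norm_sq_eq] at h1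
  refine le_trans (le_of_eq ?_) h1
  congr 1
  change _ = ∑ j : A, b j ^ 2
  rw [Finset.sum_coe_sort A (fun j => b j ^ 2)]
  refine (Finset.sum_subset (Finset.subset_univ _) fun j _ hj => ?_).symm
  rw [hb j hj]; simp

theorem inner_fit_eq_sum (b : Fin p → ℝ) (v : EuclideanSpace ℝ (Fin n)) :
    inner ℝ (fit X b) v = ∑ j, b j * inner ℝ (col X j) v := by
  simp [fit, sum_inner, real_inner_smul_left]

/-- Critical points with a common sparse support are unique. -/
theorem SparseRiesz.critical_unique (h : SparseRiesz X d cl cu) (hA : A.card ≤ d) (hγ : 0 < γ)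
    (hγcl : 1 < γ * cl) (hl : 0 < lam) (hb : ∀ j ∉ A, b j = 0) (hb' : ∀ j ∉ A, b' j = 0)
    (hc : ∀ j, IsMCPPair γ lam (b j) (corr X y b j))
    (hc' : ∀ j, IsMCPPair γ lam (b' j) (corr X y b' j)) : b = b' := by
  have h1 := h.norm_fit_sq_ge hA (b := b - b') fun j hj => by simp [hb j hj, hb' j hj]
  -- Paired with b - b', the gradient difference is minus the energy of the fit. The penalty allows
  -- at most ‖b - b'‖²/γ of energy, while the Riesz condition forces at least cl ‖b - b'‖².
  have h2 : ∑ j, (b j - b' j) * (corr X y b j - corr X y b' j) = -(‖fit X (b - b')‖ ^ 2 / n) := by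
    rw [← real_inner_self_eq_norm_sq, inner_fit_eq_sum, Finset.sum_div, ← Finset.sum_neg_distrib]
    refine Finset.sum_congr rfl fun j _ => ?_
    rw [corr, corr, ← sub_div, ← inner_sub_right, fit_sub, mul_div_assoc, ← mul_neg, ← neg_div,
      ← inner_neg_right, Pi.sub_apply]
    congr 4
    abel
  have h3 : -((∑ j, (b j - b' j) ^ 2) / γ) ≤
      ∑ j, (b j - b' j) * (corr X y b j - corr X y b' j) := by
    rw [Finset.sum_div, ← Finset.sum_neg_distrib]
    exact Finset.sum_le_sum fun j _ => (hc j).neg_sq_div_le (hc' j) hγ hl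
  have h4 : cl * ∑ j, (b j - b' j) ^ 2 ≤ (∑ j, (b j - b' j) ^ 2) / γ := by
    have : cl * ∑ j, (b j - b' j) ^ 2 ≤ ‖fit X (b - b')‖ ^ 2 / n := h1
    linarith
  have h5 : ∑ j, (b j - b' j) ^ 2 = 0 := by
    have h6 : 0 ≤ ∑ j, (b j - b' j) ^ 2 := Finset.sum_nonneg fun j _ => sq_nonneg _
    rw [le_div_iff₀ hγ] at h4
    nlinarith
  ext j
  have := (Finset.sum_eq_zero_iff_of_nonneg fun j _ => sq_nonneg _).1 h5 j (Finset.mem_univ j)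
  exact sub_eq_zero.1 (pow_eq_zero_iff two_ne_zero |>.1 this)

set_option maxHeartbeats 1000000 in
/-- If a set `A ⊇ O` of full rank consists of `O` and of indices which are active at a critical
point supported in `A`, then the residual noise explained by `A` beyond `O` is large. -/
theorem SparseRiesz.rank_bound (h : SparseRiesz X d cl cu) (hA : A.card ≤ d) (hOA : O ⊆ A)
    (hdim : O.card * (cu / cl + 1 / 2) ≤ A.card) (hlt : O.card < A.card) (hγcl : 2 ≤ γ * cl)
    (hl : 0 < lam) {bo : Fin p → ℝ} (hb : ∀ j ∉ A, b j = 0) (hbo : ∀ j ∉ O, bo j = 0)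
    (hc : ∀ j, IsMCPPair γ lam (b j) (corr X y b j))
    (hE : ∀ j ∈ A, j ∉ O → b j = 0 → lam ≤ |corr X y b j|)
    {q : EuclideanSpace ℝ (Fin n)} (hq : q ∈ colSpan X A)
    (hqy : ∀ j ∈ A, inner ℝ (col X j) (WithLp.toLp 2 y - fit X bo - q) = 0) :
    ((A.card : ℝ) - O.card) * lam ^ 2 / 4 < cu * (‖q‖ ^ 2 / n) := by
  have hcl : 0 < cl := h.1
  have hcu : 0 < cu := hcl.trans_le h.2.1
  have hγ : 0 < γ := by
    by_contra hneg
    nlinarith [mul_nonneg_of_nonpos_of_nonpos (not_lt.1 hneg) (neg_nonpos.2 hcl.le)]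
  obtain ⟨f, hf⟩ := exists_comb_eq hq
  -- This makes the linear coefficient on O equal to cl/2 and the quadratic one at least 7cl²/16, as
  -- the square completion requires; with γ cl ≥ 2 the latter is at least 7/(4γ²), enough off O.
  set δ : ℝ := cl / (4 * cu) with hδ
  have hδ0 : 0 ≤ δ := by positivity
  have hδ1 : δ ≤ 1 / 4 := by rw [hδ, div_le_div_iff₀ (by linarith) (by norm_num)]; linarith [h.2.1]
  set g := corr X y b with hg
  set w : EuclideanSpace ℝ A := WithLp.toLp 2 fun j : A => (b - bo) j with hw
  set g₁ : EuclideanSpace ℝ A := WithLp.toLp 2 fun j : A => if (j : Fin p) ∈ O then 0 else g j with hg₁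
  set g₂ : EuclideanSpace ℝ A := WithLp.toLp 2 fun j : A => if (j : Fin p) ∈ O then g j else 0 with hg₂
  have horth : inner ℝ g₁ g₂ = (0 : ℝ) := by
    rw [PiLp.inner_apply]
    refine Finset.sum_eq_zero fun j _ => ?_
    by_cases hj : (j : Fin p) ∈ O <;> simp [hg₁, hg₂, hj]
  have hfit : comb X A w = fit X (b - bo) := comb_restrict fun j hj => by
    simp [hb j hj, hbo j fun hO => hj (hOA hO)]
  -- On A the normal equations replace y by X bo + q, so the gradient at b is the Gram operator
  -- applied to f - w.
  have hTf : gram X A (f - w) = g₁ + g₂ := by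
    ext j
    have e1 : g₁ j + g₂ j = g j := by
      by_cases hj : (j : Fin p) ∈ O <;> simp [hg₁, hg₂, hj]
    rw [map_sub, PiLp.sub_apply, gram_apply, gram_apply, hf, hfit, PiLp.add_apply, e1, hg, corr,
      ← sub_div, ← inner_sub_right, fit_sub]
    congr 1
    rw [← sub_eq_zero, ← inner_sub_right, ← neg_eq_zero, ← inner_neg_right, ← hqy j j.2]
    congr 1
    abel
  have hmain := quadratic_form_lower_bound gram_isSymmetric hcl hcu hδ0 (by linarith)
    (fun u => h.gram_bounds hA u) horth hTf
  rw [inner_gram, hf, real_inner_self_eq_norm_sq] at hmain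
  refine lt_of_lt_of_le ?_ hmain
  set K := cu / cl with hK
  have hK1 : 1 ≤ K := (one_le_div hcl).2 h.2.1
  have hsum : 3 / 4 * ‖g₁‖ ^ 2 - (K - 1) / 3 * ‖g₂‖ ^ 2 + cu * (1 + δ) * inner ℝ w g₁ +
      2 * cu * δ * inner ℝ w g₂ + cu * cl * (δ * (2 - δ)) * ‖w‖ ^ 2 =
      ∑ j ∈ A, (3 / 4 * (if j ∈ O then 0 else g j) ^ 2 -
        (K - 1) / 3 * (if j ∈ O then g j else 0) ^ 2 +
        cu * (1 + δ) * ((b j - bo j) * (if j ∈ O then 0 else g j)) +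
        2 * cu * δ * ((b j - bo j) * (if j ∈ O then g j else 0)) +
        cu * cl * (δ * (2 - δ)) * (b j - bo j) ^ 2) := by
    rw [← Finset.sum_coe_sort A]
    simp only [Finset.sum_add_distrib, Finset.sum_sub_distrib, ← Finset.mul_sum]
    simp only [EuclideanSpace.real_norm_sq_eq, PiLp.inner_apply, hg₁, hg₂, hw, Pi.sub_apply,
      RCLike.inner_apply, conj_trivial, mul_comm]
  rw [hsum, ← Finset.sum_sdiff hOA]
  have hcδ : cu * cl * (δ * (2 - δ)) = cl ^ 2 * (2 - δ) / 4 := by rw [hδ]; field_simp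
  have hcδ' : 2 * cu * δ = cl / 2 := by rw [hδ]; field_simp; ring
  have hτ : 7 / 16 * cl ^ 2 ≤ cu * cl * (δ * (2 - δ)) := by
    rw [hcδ]; nlinarith [sq_nonneg cl]
  have hB : ((A.card : ℝ) - O.card) * (3 / 4 * lam ^ 2) ≤
      ∑ j ∈ A \ O, (3 / 4 * (if j ∈ O then 0 else g j) ^ 2 -
        (K - 1) / 3 * (if j ∈ O then g j else 0) ^ 2 +
        cu * (1 + δ) * ((b j - bo j) * (if j ∈ O then 0 else g j)) +
        2 * cu * δ * ((b j - bo j) * (if j ∈ O then g j else 0)) +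
        cu * cl * (δ * (2 - δ)) * (b j - bo j) ^ 2) := by
    rw [← Nat.cast_sub hlt.le, ← Finset.card_sdiff_of_subset hOA, ← nsmul_eq_mul]
    refine Finset.card_nsmul_le_sum _ _ _ fun j hj => ?_
    obtain ⟨hjA, hjO⟩ := Finset.mem_sdiff.1 hj
    simp only [hjO, if_false, hbo j hjO, sub_zero]
    have hact : lam ≤ |g j| + |b j| / γ := by
      by_cases hbj : b j = 0
      · simpa [hbj] using hE j hjA hjO hbj
      · exact (hc j).le_abs_add hγ hl hbj
    have := three_quarters_sq_le (cl := cl) (cu := cu) (δ := δ) hl.le hγ hδ0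
      (by nlinarith [h.2.1]) (by nlinarith [mul_le_mul_of_nonneg_right hτ (sq_nonneg γ)])
      ((hc j).mul_nonneg hγ hl) hact
    linarith
  have hO : (O.card : ℝ) * (-(((K - 1) / 3 + 1 / 7) * lam ^ 2)) ≤
      ∑ j ∈ O, (3 / 4 * (if j ∈ O then 0 else g j) ^ 2 -
        (K - 1) / 3 * (if j ∈ O then g j else 0) ^ 2 +
        cu * (1 + δ) * ((b j - bo j) * (if j ∈ O then 0 else g j)) +
        2 * cu * δ * ((b j - bo j) * (if j ∈ O then g j else 0)) +
        cu * cl * (δ * (2 - δ)) * (b j - bo j) ^ 2) := by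
    rw [← nsmul_eq_mul]
    refine Finset.card_nsmul_le_sum _ _ _ fun j hj => ?_
    simp only [hj, if_true]
    rw [hcδ']
    have hgl : g j ^ 2 ≤ lam ^ 2 := by
      rw [← sq_abs]; exact pow_le_pow_left₀ (abs_nonneg _) ((hc j).abs_le hγ hl) 2
    refine (neg_mul_sq_le (x := b j - bo j) hτ hgl (by linarith : 0 ≤ (K - 1) / 3)).trans
      (le_of_eq ?_)
    ring
  refine lt_of_lt_of_le ?_ (add_le_add hB hO)
  have hl2 : 0 < lam ^ 2 := by positivity
  have hlt' : (O.card : ℝ) < A.card := by exact_mod_cast hlt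
  have hO0 : (0 : ℝ) ≤ O.card := Nat.cast_nonneg _
  -- By `hdim`, half of |A| - |O| is at least (K/2 - 1/4)|O|, which exceeds the loss (K/3 - 4/21)|O|
  -- when O is nonempty; for empty O, strictness comes from |A| > 0.
  have key : ((A.card : ℝ) - O.card) / 4 <
      (A.card - O.card) * (3 / 4) - O.card * ((K - 1) / 3 + 1 / 7) := by
    rcases hO0.eq_or_lt with h0 | h0
    · rw [← h0] at hlt' ⊢; linarith
    · nlinarith
  nlinarith

end Regression


/-! ### The oracle and the noise beyond its span -/

section Oracle

variable {n p : ℕ} {X : Matrix (Fin n) (Fin p) ℝ} {A O : Finset (Fin p)} {d : ℕ}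
  {cl cu γ lam : ℝ} {y : Fin n → ℝ} {b : Fin p → ℝ}

/-- `b` is supported in `O` and satisfies the normal equations of the regression on `X_O`. -/
structure IsOracle (X : Matrix (Fin n) (Fin p) ℝ) (y : Fin n → ℝ) (O : Finset (Fin p))
    (b : Fin p → ℝ) : Prop where
  eq_zero : ∀ j ∉ O, b j = 0
  inner_eq_zero : ∀ v ∈ colSpan X O, inner ℝ v (WithLp.toLp 2 y - fit X b) = 0

theorem exists_isOracle (X : Matrix (Fin n) (Fin p) ℝ) (y : Fin n → ℝ) (O : Finset (Fin p)) :
    ∃ b, IsOracle X y O b := by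
  obtain ⟨b, hb, hfit⟩ := exists_fit_eq (X := X) (A := O)
    ((colSpan X O).starProjection_apply_mem (WithLp.toLp 2 y))
  refine ⟨b, hb, fun v hv => ?_⟩
  rw [hfit]
  exact (Submodule.sub_starProjection_mem_orthogonal _) v hv

theorem IsOracle.isLSE (h : IsOracle X y O b) : IsLSE X y O b := by
  refine ⟨h.eq_zero, fun b' hb' => ?_⟩
  have key : ∀ c : Fin p → ℝ,
      ∑ k, (y k - X.mulVec c k) ^ 2 = ‖WithLp.toLp 2 y - fit X c‖ ^ 2 := by
    intro c
    rw [EuclideanSpace.real_norm_sq_eq]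
    exact Finset.sum_congr rfl fun k _ => by rw [PiLp.sub_apply, fit_apply]
  rw [key, key]
  have h1 : WithLp.toLp 2 y - fit X b' = (WithLp.toLp 2 y - fit X b) + fit X (b - b') := by
    rw [fit_sub]; abel
  have h2 := h.inner_eq_zero (fit X (b - b'))
    (fit_mem_colSpan fun j hj => by simp [h.eq_zero j hj, hb' j hj])
  rw [h1, norm_add_sq_real, real_inner_comm, h2]
  nlinarith [sq_nonneg ‖fit X (b - b')‖]

theorem IsOracle.corr_eq_zero (h : IsOracle X y O b) {j : Fin p} (hj : j ∈ O) :
    corr X y b j = 0 := by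
  rw [corr, h.inner_eq_zero _ (col_mem_colSpan hj), zero_div]

/-- Coefficients of size at least γ λ lie where the penalty is flat, so the normal equations are the
critical equations there. -/
theorem IsOracle.isMCPPair (h : IsOracle X y O b) (hγ : 0 < γ) (hl : 0 < lam)
    (hbig : ∀ j ∈ O, γ * lam ≤ |b j|) (hsmall : ∀ j ∉ O, |corr X y b j| ≤ lam) (j : Fin p) :
    IsMCPPair γ lam (b j) (corr X y b j) := by
  by_cases hj : j ∈ O
  · have h1 := hbig j hj
    refine ⟨fun _ => ?_, fun h0 => ?_⟩
    · rw [h.corr_eq_zero hj, mcpDeriv_eq hγ hl, max_eq_right, mul_zero]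
      rw [sub_nonpos, le_div_iff₀ hγ]
      linarith
    · rw [h.corr_eq_zero hj, abs_zero]; exact hl.le
  · exact ⟨fun h0 => absurd (h.eq_zero j hj) h0, fun _ => hsmall j hj⟩

/-- The orthogonal complement of the column span of `O` in that of `A`. -/
noncomputable def extraSpan (X : Matrix (Fin n) (Fin p) ℝ) (O A : Finset (Fin p)) :
    Submodule ℝ (EuclideanSpace ℝ (Fin n)) :=
  (colSpan X O)ᗮ ⊓ colSpan X A

/-- The squared length of the component of the noise `e` in `extraSpan X O A`. -/
noncomputable def extraNoise (X : Matrix (Fin n) (Fin p) ℝ) (O A : Finset (Fin p))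
    (e : Fin n → ℝ) : ℝ :=
  ‖(extraSpan X O A).orthogonalProjectionOnto (WithLp.toLp 2 e)‖ ^ 2

/-- Split the column into its projection u on span X_O and the rest. The vector u is orthogonal to
the oracle residual and to q; the rest is orthogonal to all fits on O and sees the noise only
through q. -/
theorem IsOracle.inner_sub_extra_eq_zero {β : Fin p → ℝ} {e : Fin n → ℝ}
    (h : IsOracle X (fun k => X.mulVec β k + e k) O b) (hβ : ∀ j ∉ O, β j = 0) (hOA : O ⊆ A)
    {j : Fin p} (hj : j ∈ A) :
    inner ℝ (col X j) (WithLp.toLp 2 (fun k => X.mulVec β k + e k) - fit X b -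
      ((extraSpan X O A).orthogonalProjectionOnto (WithLp.toLp 2 e) :
        EuclideanSpace ℝ (Fin n))) = 0 := by
  set q := (extraSpan X O A).orthogonalProjectionOnto (WithLp.toLp 2 e) with hq
  set u : EuclideanSpace ℝ (Fin n) := (colSpan X O).starProjection (col X j) with hu
  have hu0 : u ∈ colSpan X O := Submodule.starProjection_apply_mem _ _
  have hx : col X j - u ∈ extraSpan X O A :=
    ⟨Submodule.sub_starProjection_mem_orthogonal _,
      Submodule.sub_mem _ (col_mem_colSpan hj) (colSpan_mono hOA hu0)⟩
  have hy : WithLp.toLp 2 (fun k => X.mulVec β k + e k) = fit X β + WithLp.toLp 2 e := by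
    rw [← toLp_mulVec]; rfl
  have hq0 : inner ℝ u (q : EuclideanSpace ℝ (Fin n)) = 0 := q.2.1 u hu0
  have h1 : inner ℝ u (WithLp.toLp 2 (fun k => X.mulVec β k + e k) - fit X b - q) = (0 : ℝ) := by
    rw [inner_sub_right, h.inner_eq_zero u hu0, hq0, sub_zero]
  have h2 : ∀ c : Fin p → ℝ, (∀ j ∉ O, c j = 0) → inner ℝ (col X j - u) (fit X c) = (0 : ℝ) :=
    fun c hc => by
      rw [real_inner_comm]
      exact hx.1 _ (fit_mem_colSpan hc)
  have h3 : inner ℝ (col X j - u) (q : EuclideanSpace ℝ (Fin n)) =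
      inner ℝ (col X j - u) (WithLp.toLp 2 e) :=
    Submodule.inner_orthogonalProjectionOnto_eq_of_mem_left ⟨_, hx⟩ _
  have h4 : inner ℝ (col X j - u) (WithLp.toLp 2 (fun k => X.mulVec β k + e k) - fit X b - q) =
      (0 : ℝ) := by
    rw [hy, inner_sub_right, inner_sub_right, inner_add_right, h2 β hβ, h2 b h.eq_zero, h3]
    ring
  calc _ = inner ℝ (u + (col X j - u)) _ := by rw [add_sub_cancel]
    _ = 0 := by rw [inner_add_left, h1, h4, add_zero]

theorem continuous_corr (j : Fin p) : Continuous fun c => corr X y c j := by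
  unfold corr fit
  fun_prop

end Oracle

/-! ### Sparsity along a main branch -/

section Path

variable {n p : ℕ} {X : Matrix (Fin n) (Fin p) ℝ} {A O : Finset (Fin p)} {d : ℕ}
  {cl cu γ l lam₁ : ℝ} {y : Fin n → ℝ} {b : Fin p → ℝ}

theorem mem_support {b : Fin p → ℝ} {j : Fin p} : j ∈ support b ↔ b j ≠ 0 := by
  simp [support]

/-- Sparsity fails exactly when all coordinates in some B with |B ∪ O| > d are nonzero, an open
condition; there are finitely many B. -/
theorem isClosed_sparse {beta : ℝ → Fin p → ℝ} {a c : ℝ}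
    (h : ContinuousOn beta (Set.Icc a c)) (O : Finset (Fin p)) (d : ℕ) :
    IsClosed ({x | (support (beta x) ∪ O).card ≤ d} ∩ Set.Icc a c) := by
  have hset : {x | (support (beta x) ∪ O).card ≤ d} ∩ Set.Icc a c =
      Set.Icc a c ∩ ⋂ B : {B : Finset (Fin p) // d < (B ∪ O).card},
        ⋃ j ∈ B.1, Set.Icc a c ∩ (fun x => beta x j) ⁻¹' {0} := by
    ext x
    simp only [Set.mem_inter_iff, Set.mem_ofPred_eq, Set.mem_iInter, Set.mem_iUnion,
      Set.mem_preimage, Set.mem_singleton_iff, Subtype.forall, exists_prop]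
    constructor
    · rintro ⟨h1, hx⟩
      refine ⟨hx, fun B hB => ?_⟩
      by_contra hcon
      have hsub : B ⊆ support (beta x) := fun j hj =>
        mem_support.2 fun h0 => hcon ⟨j, hj, hx, h0⟩
      exact absurd ((Finset.card_le_card (Finset.union_subset_union_left hsub)).trans h1)
        (not_le.2 hB)
    · rintro ⟨hx, h1⟩
      refine ⟨?_, hx⟩
      by_contra hcon
      obtain ⟨j, hj, -, h0⟩ := h1 _ (not_le.1 hcon)
      exact mem_support.1 hj h0
  rw [hset]
  refine isClosed_Icc.inter (isClosed_iInter fun B => isClosed_biUnion_finset fun j _ => ?_)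
  exact ((continuous_apply j).comp_continuousOn h).preimage_isClosed_of_isClosed isClosed_Icc
    isClosed_singleton

/-- The indices which may enter the support near a sparse critical point are few. -/
theorem card_active_le (hSRC : SparseRiesz X d cl cu) {β : Fin p → ℝ} {e : Fin n → ℝ}
    (hdim : (support β).card * (cu / cl + 1 / 2) ≤ d) (hlt : (support β).card < d)
    (hγcl : 2 ≤ γ * cl) (hγ : 0 < γ) (hl : 0 < l) (hlam₁ : 0 ≤ lam₁) {bo : Fin p → ℝ}
    (hbo : IsOracle X (fun k => X.mulVec β k + e k) (support β) bo)
    (hnoise : d < p → ∀ A, support β ⊆ A → A.card = d →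
      cu * (extraNoise X (support β) A e / n) ≤ ((d : ℝ) - (support β).card) * lam₁ ^ 2 / 4)
    (hbig : ∀ j ∈ support β, γ * max lam₁ l ≤ |bo j|)
    (hsmall : ∀ j ∉ support β, |corr X (fun k => X.mulVec β k + e k) bo j| < l)
    {lam : ℝ} (hlam : l < lam)
    (hb : ∀ j, IsMCPPair γ lam (b j) (corr X (fun k => X.mulVec β k + e k) b j))
    (hsparse : (support b ∪ support β).card ≤ d) :
    ((Finset.univ.filter fun j =>
      b j ≠ 0 ∨ lam ≤ |corr X (fun k => X.mulVec β k + e k) b j|) ∪ support β).card ≤ d := by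
  set y := fun k => X.mulVec β k + e k with hy
  set O := support β with hO
  set E := Finset.univ.filter fun j => b j ≠ 0 ∨ lam ≤ |corr X y b j| with hE
  have hl0 : 0 < lam := hl.trans hlam
  have hbz : ∀ A : Finset (Fin p), support b ⊆ A → ∀ j ∉ A, b j = 0 := fun A hA j hj => by
    by_contra h0
    exact hj (hA (mem_support.2 h0))
  by_contra hcon
  rw [not_le] at hcon
  -- At low levels the oracle is critical too and uniqueness identifies b with it; its gradient off
  -- O is below the level, so nothing outside O can enter.
  rcases le_or_gt lam (max lam₁ l) with hle | hgt
  · have heq : b = bo := hSRC.critical_unique hsparse hγ (by linarith) hl0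
      (hbz _ Finset.subset_union_left)
      (fun j hj => hbo.eq_zero j fun h => hj (Finset.mem_union_right _ h)) hb
      (hbo.isMCPPair hγ hl0
        (fun j hj => (mul_le_mul_of_nonneg_left hle hγ.le).trans (hbig j hj))
        fun j hj => (hsmall j hj).le.trans hlam.le)
    have hsub : E ∪ O ⊆ O := by
      refine Finset.union_subset (fun j hj => ?_) (Finset.Subset.refl _)
      by_contra hjO
      rcases (Finset.mem_filter.1 hj).2 with h | h
      · exact h (by rw [heq, hbo.eq_zero j hjO])
      · rw [heq] at h
        linarith [hsmall j hjO]
    exact absurd (Finset.card_le_card hsub) (by omega)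
  · have hsub : support b ∪ O ⊆ E ∪ O := by
      refine Finset.union_subset_union_left fun j hj => ?_
      exact Finset.mem_filter.2 ⟨Finset.mem_univ _, Or.inl (mem_support.1 hj)⟩
    -- Size exactly d keeps A within the Riesz rank and matches the sets controlled by the noise
    -- event.
    obtain ⟨A, hA1, hA2, hAc⟩ := Finset.exists_subsuperset_card_eq hsub hsparse hcon.le
    have hOA : O ⊆ A := Finset.subset_union_right.trans hA1
    have hdp : d < p := hcon.trans_le (by simpa using Finset.card_le_univ (E ∪ O))
    have h1 := hSRC.rank_bound (y := y) hAc.le hOA (by rw [hAc]; exact hdim)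
      (by rw [hAc]; exact hlt) hγcl hl0 (hbz A (Finset.subset_union_left.trans hA1)) hbo.eq_zero hb
      (fun j hj hjO hbj => by
        rcases Finset.mem_union.1 (hA2 hj) with h | h
        · exact (Finset.mem_filter.1 h).2.resolve_left fun h => h hbj
        · exact absurd h hjO)
      (q := (extraSpan X O A).orthogonalProjectionOnto (WithLp.toLp 2 e))
      (Subtype.coe_prop ((extraSpan X O A).orthogonalProjectionOnto (WithLp.toLp 2 e))).2
      (fun j hj => hbo.inner_sub_extra_eq_zero
        (fun j hj => not_not.1 fun h => hj (mem_support.2 h)) hOA hj)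
    have h2 := hnoise hdp A hOA hAc
    rw [hAc] at h1
    have h3 : lam₁ ^ 2 ≤ lam ^ 2 := by
      have := (le_max_left lam₁ l).trans hgt.le
      gcongr
    have h4 : (0 : ℝ) ≤ (d : ℝ) - O.card := by
      have : (O.card : ℝ) ≤ d := by exact_mod_cast hlt.le
      linarith
    have h5 := mul_le_mul_of_nonneg_left h3 h4
    rw [← Submodule.coe_norm] at h1
    have h6 := h1.trans_le h2
    linarith

/-- On a favourable realization of the noise every estimate along a main branch is the oracle
least squares estimate. -/
theorem IsMCPlus.eq_oracle (hSRC : SparseRiesz X d cl cu) {β : Fin p → ℝ} {e : Fin n → ℝ}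
    (hdim : (support β).card * (cu / cl + 1 / 2) ≤ d) (hlt : (support β).card < d)
    (hγcl : 2 ≤ γ * cl) (hγ : 0 < γ) (hl : 0 < l) (hlam₁ : 0 ≤ lam₁) {bo : Fin p → ℝ}
    (hbo : IsOracle X (fun k => X.mulVec β k + e k) (support β) bo)
    (hnoise : d < p → ∀ A, support β ⊆ A → A.card = d →
      cu * (extraNoise X (support β) A e / n) ≤ ((d : ℝ) - (support β).card) * lam₁ ^ 2 / 4)
    (hbig : ∀ j ∈ support β, γ * max lam₁ l ≤ |bo j|)
    (hsmall : ∀ j ∉ support β, |corr X (fun k => X.mulVec β k + e k) bo j| < l)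
    (h : IsMCPlus X (fun k => X.mulVec β k + e k) γ l b) : b = bo := by
  obtain ⟨lam, beta, hbr, rfl⟩ := h
  set y := fun k => X.mulVec β k + e k with hy
  set S := {x : ℝ | 0 ≤ x ∧ lam x ≤ l} with hS
  have hSne : S.Nonempty := by
    obtain ⟨x, hx1, hx2⟩ := ((hbr.tendsto_lam.eventually (gt_mem_nhds hl)).and
      (eventually_ge_atTop 0)).exists
    exact ⟨x, hx2, hx1.le⟩
  have hSbdd : BddBelow S := ⟨0, fun x hx => hx.1⟩
  have hScl : IsClosed S :=
    hbr.continuousOn_lam.preimage_isClosed_of_isClosed isClosed_Ici isClosed_Iic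
  set x₀ := sInf S with hx₀
  have hx₀S : x₀ ∈ S := hScl.csInf_mem hSne hSbdd
  have hbefore : ∀ x ∈ Set.Ico 0 x₀, l < lam x := fun x hx => by
    by_contra hcon
    exact absurd (csInf_le hSbdd ⟨hx.1, not_lt.1 hcon⟩) (not_le.2 hx.2)
  have hcrit : ∀ x, 0 ≤ x → ∀ j, IsMCPPair γ (lam x) (beta x j) (corr X y (beta x) j) :=
    fun x hx => isCritical_iff.1 (hbr.critical x hx)
  -- Continuous induction on [0, x₀]: the path starts at zero, sparsity is closed, and it persists a
  -- little to the right.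
  have hsub : Set.Icc 0 x₀ ⊆ {x | (support (beta x) ∪ support β).card ≤ d} := by
    refine (isClosed_sparse (hbr.continuousOn_beta.mono Set.Icc_subset_Ici_self)
      _ _).Icc_subset_of_forall_mem_nhdsWithin ?_ ?_
    · have : support (beta 0) = ∅ := by
        ext j; simp [hbr.beta_zero, support]
      simp only [Set.mem_ofPred_eq, this, Finset.empty_union]
      exact hlt.le
    · rintro x ⟨hxs, hx⟩
      have hlx := hbefore x hx
      have hE := card_active_le hSRC hdim hlt hγcl hγ hl hlam₁ hbo hnoise hbig hsmall hlx
        (hcrit x hx.1) hxs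
      have hnhds : 𝓝[>] x ≤ 𝓝[Set.Ici 0] x :=
        nhdsWithin_mono _ fun z hz => hx.1.trans (le_of_lt hz)
      have hlam : ∀ᶠ z in 𝓝[>] x, 0 < lam z :=
        ((hbr.continuousOn_lam x hx.1).mono_left hnhds).eventually (lt_mem_nhds (hl.trans hlx))
      -- A nonzero coefficient forces λ ≤ |g| + |b|/γ. The strict reverse inequality holds at x and
      -- persists by continuity.
      have hinact : ∀ᶠ z in 𝓝[>] x, ∀ j, ¬ (beta x j ≠ 0 ∨ lam x ≤ |corr X y (beta x) j|) →
          beta z j = 0 := by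
        rw [eventually_all]
        intro j
        by_cases hj : beta x j ≠ 0 ∨ lam x ≤ |corr X y (beta x) j|
        · exact Eventually.of_forall fun z h => absurd hj h
        · obtain ⟨hj1, hj2⟩ := not_or.1 hj
          have hF : ContinuousWithinAt
              (fun z => lam z - (|corr X y (beta z) j| + |beta z j| / γ)) (Set.Ici 0) x := by
            have hβ := hbr.continuousOn_beta x hx.1
            have h1 : ContinuousWithinAt (fun z => corr X y (beta z) j) (Set.Ici 0) x :=
              (continuous_corr j).continuousAt.comp_continuousWithinAt hβ
            have h2 : ContinuousWithinAt (fun z => beta z j) (Set.Ici 0) x :=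
              (continuous_apply j).continuousAt.comp_continuousWithinAt hβ
            exact (hbr.continuousOn_lam x hx.1).sub (h1.abs.add (h2.abs.div_const γ))
          have hF0 : 0 < lam x - (|corr X y (beta x) j| + |beta x j| / γ) := by
            rw [not_not.1 hj1]
            simp only [abs_zero, zero_div, add_zero]
            linarith [not_le.1 hj2]
          filter_upwards [(hF.mono_left hnhds).eventually (lt_mem_nhds hF0), hlam,
            self_mem_nhdsWithin] with z hz hlz hxz _
          by_contra hne
          have := (hcrit z (hx.1.trans (le_of_lt hxz)) j).le_abs_add hγ hlz hne
          linarith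
      filter_upwards [hinact] with z hz
      refine le_trans (Finset.card_le_card (Finset.union_subset_union_left fun j hj => ?_)) hE
      refine Finset.mem_filter.2 ⟨Finset.mem_univ _, ?_⟩
      by_contra hcon
      exact mem_support.1 hj (hz j hcon)
  -- If x₀ = 0 the level may lie strictly below l, but the zero vector remains critical at l;
  -- otherwise continuity gives level exactly l.
  have hfinal : ∀ j, IsMCPPair γ l (beta x₀ j) (corr X y (beta x₀) j) := by
    rcases hx₀S.1.eq_or_lt with h0 | h0
    · intro j
      have hz : beta x₀ j = 0 := by rw [← h0, hbr.beta_zero]; rfl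
      exact ⟨fun h => absurd hz h, fun _ => ((hcrit x₀ hx₀S.1 j).2 hz).trans hx₀S.2⟩
    · have hge : l ≤ lam x₀ := by
        have hne : (𝓝[<] x₀).NeBot := inferInstance
        have hle : 𝓝[Set.Ico 0 x₀] x₀ ≤ 𝓝[Set.Ici 0] x₀ :=
          nhdsWithin_mono _ fun z hz => hz.1
        have hne' : (𝓝[Set.Ico 0 x₀] x₀).NeBot := by
          rw [nhdsWithin_Ico_eq_nhdsLT h0]; exact hne
        exact ge_of_tendsto ((hbr.continuousOn_lam x₀ hx₀S.1).mono_left hle)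
          (by filter_upwards [self_mem_nhdsWithin] with z hz using (hbefore z hz).le)
      have heq : lam x₀ = l := le_antisymm hx₀S.2 hge
      rw [← heq]
      exact hcrit x₀ hx₀S.1
  refine hSRC.critical_unique (hsub ⟨hx₀S.1, le_rfl⟩) hγ (by linarith) hl
    (fun j hj => ?_) (fun j hj => hbo.eq_zero j fun h => hj (Finset.mem_union_right _ h)) hfinal
    (hbo.isMCPPair hγ hl
      (fun j hj => (mul_le_mul_of_nonneg_left (le_max_right _ _) hγ.le).trans (hbig j hj))
      fun j hj => (hsmall j hj).le)
  by_contra h0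
  exact hj (Finset.mem_union_left _ (mem_support.2 h0))

end Path


/-! ### Dimensions and linear functionals of the noise -/

section Vectors

variable {n p : ℕ} {X : Matrix (Fin n) (Fin p) ℝ} {A O : Finset (Fin p)} {d : ℕ}
  {cl cu : ℝ}

theorem SparseRiesz.linearIndependent_col (h : SparseRiesz X d cl cu) (hA : A.card ≤ d) :
    LinearIndependent ℝ fun j : A => col X j := by
  rw [Fintype.linearIndependent_iff]
  intro c hc j
  have h1 := (h.gram_bounds hA (WithLp.toLp 2 c)).1
  have h2 : comb X A (WithLp.toLp 2 c) = 0 := hc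
  rw [inner_gram, h2, inner_zero_left, zero_div] at h1
  have h3 : ‖(WithLp.toLp 2 c : EuclideanSpace ℝ A)‖ ^ 2 ≤ 0 := by
    have := h.1
    by_contra hcon
    nlinarith [not_le.1 hcon]
  have h4 : (WithLp.toLp 2 c : EuclideanSpace ℝ A) = 0 :=
    norm_eq_zero.1 (pow_eq_zero_iff two_ne_zero |>.1 (le_antisymm h3 (sq_nonneg _)))
  exact congrFun (congrArg WithLp.ofLp h4) j

theorem SparseRiesz.finrank_colSpan (h : SparseRiesz X d cl cu) (hA : A.card ≤ d) :
    Module.finrank ℝ (colSpan X A) = A.card := by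
  rw [colSpan, finrank_span_eq_card (h.linearIndependent_col hA), Fintype.card_coe]

theorem SparseRiesz.finrank_extraSpan (h : SparseRiesz X d cl cu) (hA : A.card ≤ d)
    (hOA : O ⊆ A) : Module.finrank ℝ (extraSpan X O A) = A.card - O.card := by
  have h1 := Submodule.finrank_add_inf_finrank_orthogonal (colSpan_mono (X := X) hOA)
  rw [h.finrank_colSpan hA, h.finrank_colSpan ((Finset.card_le_card hOA).trans hA)] at h1
  rw [extraSpan]
  omega

theorem SparseRiesz.sample_size_pos (h : SparseRiesz X d cl cu) (hA : A.card ≤ d)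
    (hne : A.Nonempty) : 0 < n := by
  obtain ⟨j, hj⟩ := hne
  rcases Nat.eq_zero_or_pos n with rfl | hn
  · exfalso
    have h1 := (h.gram_bounds hA (EuclideanSpace.single ⟨j, hj⟩ 1)).1
    rw [inner_gram] at h1
    simp at h1
    linarith [h.1]
  · exact hn

/-- The vector whose inner product with the response is the `j`-th least squares coefficient in
the regression on `X_A`. -/
noncomputable def coefVec (X : Matrix (Fin n) (Fin p) ℝ) (A : Finset (Fin p)) (j : A) :
    EuclideanSpace ℝ (Fin n) :=
  (n : ℝ)⁻¹ • comb X A (WithLp.toLp 2 ((subGram X A)⁻¹.mulVec (Pi.single j 1)))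

theorem coefVec_mem (j : A) : coefVec X A j ∈ colSpan X A := by
  rw [coefVec, comb]
  exact Submodule.smul_mem _ _
    (Submodule.sum_mem _ fun i _ => Submodule.smul_mem _ _ (col_mem_colSpan i.2))

theorem SparseRiesz.gram_inv (h : SparseRiesz X d cl cu) (hA : A.card ≤ d) (j : A) :
    gram X A (WithLp.toLp 2 ((subGram X A)⁻¹.mulVec (Pi.single j 1))) =
      EuclideanSpace.single j 1 := by
  have hmul : ∀ c : A → ℝ, gram X A (WithLp.toLp 2 c) = WithLp.toLp 2 ((subGram X A).mulVec c) :=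
    fun c => rfl
  have hinj : Function.Injective (subGram X A).mulVec := by
    intro c c' hcc
    have h1 : gram X A (WithLp.toLp 2 (c - c')) = 0 := by
      rw [hmul, Matrix.mulVec_sub, hcc, sub_self]; rfl
    have h2 := (h.gram_bounds hA (WithLp.toLp 2 (c - c'))).1
    rw [h1, inner_zero_left] at h2
    have h3 : ‖(WithLp.toLp 2 (c - c') : EuclideanSpace ℝ A)‖ ^ 2 ≤ 0 := by
      have := h.1
      by_contra hcon
      nlinarith [not_le.1 hcon]
    have h4 : (WithLp.toLp 2 (c - c') : EuclideanSpace ℝ A) = 0 :=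
      norm_eq_zero.1 (pow_eq_zero_iff two_ne_zero |>.1 (le_antisymm h3 (sq_nonneg _)))
    exact sub_eq_zero.1 (congrArg WithLp.ofLp h4)
  have hdet := (Matrix.isUnit_iff_isUnit_det _).1 (Matrix.mulVec_injective_iff_isUnit.1 hinj)
  rw [hmul, Matrix.mulVec_mulVec, Matrix.mul_nonsing_inv _ hdet, Matrix.one_mulVec]
  rfl

/-- The vectors `coefVec` are dual to the columns in A, so an oracle error is a single inner product
with the noise. -/
theorem SparseRiesz.inner_coefVec_fit (h : SparseRiesz X d cl cu) (hA : A.card ≤ d) (j : A)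
    {c : Fin p → ℝ} (hc : ∀ j ∉ A, c j = 0) : inner ℝ (coefVec X A j) (fit X c) = c j := by
  rw [coefVec, real_inner_smul_left, ← comb_restrict hc, inv_mul_eq_div, ← inner_gram,
    h.gram_inv hA]
  simp [EuclideanSpace.inner_single_left]

theorem SparseRiesz.norm_coefVec_sq (h : SparseRiesz X d cl cu) (hA : A.card ≤ d) (j : A) :
    ‖coefVec X A j‖ ^ 2 = (subGram X A)⁻¹ j j / n := by
  rw [← real_inner_self_eq_norm_sq, coefVec, real_inner_smul_left, real_inner_smul_right,
    inv_mul_eq_div, inv_mul_eq_div, ← inner_gram, h.gram_inv hA]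
  simp [EuclideanSpace.inner_single_left]

theorem le_maxInvDiag (j : A) : (subGram X A)⁻¹ j j ≤ maxInvDiag X A :=
  le_ciSup (f := fun j : A => (subGram X A)⁻¹ j j) (Set.finite_range _).bddAbove j

/-- The component of the `j`-th column orthogonal to the columns in `A`. -/
noncomputable def residCol (X : Matrix (Fin n) (Fin p) ℝ) (A : Finset (Fin p)) (j : Fin p) :
    EuclideanSpace ℝ (Fin n) :=
  col X j - (colSpan X A).starProjection (col X j)

theorem norm_residCol_le (j : Fin p) : ‖residCol X A j‖ ≤ ‖col X j‖ := by
  have h : residCol X A j = (colSpan X A)ᗮ.starProjection (col X j) := by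
    rw [residCol, Submodule.starProjection_orthogonal_val]
  rw [h]
  exact Submodule.norm_starProjection_apply_le _ _

theorem toLp_response (β : Fin p → ℝ) (e : Fin n → ℝ) :
    WithLp.toLp 2 (fun k => X.mulVec β k + e k) = fit X β + WithLp.toLp 2 e := by
  rw [← toLp_mulVec]; rfl

variable {β b : Fin p → ℝ} {e : Fin n → ℝ}

/-- Fits supported in A are orthogonal to `residCol`, so only the noise remains. -/
theorem IsOracle.corr_eq (h : IsOracle X (fun k => X.mulVec β k + e k) A b)
    (hβ : ∀ j ∉ A, β j = 0) (j : Fin p) :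
    corr X (fun k => X.mulVec β k + e k) b j = inner ℝ (residCol X A j) (WithLp.toLp 2 e) / n := by
  have h0 : ∀ c : Fin p → ℝ, (∀ j ∉ A, c j = 0) → inner ℝ (residCol X A j) (fit X c) = (0 : ℝ) :=
    fun c hc => by
      rw [real_inner_comm]
      exact Submodule.sub_starProjection_mem_orthogonal (K := colSpan X A) (col X j) _
        (fit_mem_colSpan hc)
  have h1 : inner ℝ (col X j) (WithLp.toLp 2 (fun k => X.mulVec β k + e k) - fit X b) =
      inner ℝ (residCol X A j) (WithLp.toLp 2 (fun k => X.mulVec β k + e k) - fit X b) := by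
    rw [residCol, inner_sub_left,
      h.inner_eq_zero _ (Submodule.starProjection_apply_mem _ _), sub_zero]
  rw [corr, h1, toLp_response, inner_sub_right, inner_add_right, h0 β hβ, h0 b h.eq_zero]
  simp

theorem IsOracle.sub_eq (h : IsOracle X (fun k => X.mulVec β k + e k) A b)
    (hSRC : SparseRiesz X d cl cu) (hA : A.card ≤ d) (hβ : ∀ j ∉ A, β j = 0) (j : A) :
    b j - β j = inner ℝ (coefVec X A j) (WithLp.toLp 2 e) := by
  have h1 := h.inner_eq_zero _ (coefVec_mem j)
  rw [toLp_response, inner_sub_right, inner_add_right, hSRC.inner_coefVec_fit hA j hβ,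
    hSRC.inner_coefVec_fit hA j h.eq_zero] at h1
  linarith

theorem sign_eq_of_abs_sub_lt {x z : ℝ} (h : |x - z| < |z|) : Real.sign x = Real.sign z := by
  rcases lt_trichotomy z 0 with hz | rfl | hz
  · rw [abs_of_neg hz] at h
    rw [Real.sign_of_neg hz, Real.sign_of_neg (by linarith [(abs_lt.1 h).2])]
  · simp only [abs_zero] at h
    exact absurd h (not_lt.2 (abs_nonneg _))
  · rw [abs_of_pos hz] at h
    rw [Real.sign_of_pos hz, Real.sign_of_pos (by linarith [(abs_lt.1 h).1])]

end Vectors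

/-! ### Tail bounds for the three exceptional events -/

section Probability

variable {n p d : ℕ} {σ cl cu γ : ℝ} {X : Matrix (Fin n) (Fin p) ℝ} {β : Fin p → ℝ}

theorem SparseRiesz.noiseLaw_coefVec_le (h : SparseRiesz X d cl cu) (hσ : 0 < σ)
    {A : Finset (Fin p)} (hA : A.card ≤ d) (hA2 : 2 ≤ A.card) (hlog : 1 < 2 * Real.log A.card) :
    noiseLaw n σ (⋃ j : A, {e | σ * Real.sqrt (maxInvDiag X A * (2 / n) * Real.log A.card) ≤
      |inner ℝ (coefVec X A j) (WithLp.toLp 2 e)|}) ≤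
      ENNReal.ofReal (A.card * chiTail 1 (2 * Real.log A.card)) := by
  have hn : 0 < n := h.sample_size_pos hA (Finset.card_pos.1 (by omega))
  have hn' : (0 : ℝ) < n := by exact_mod_cast hn
  refine (measure_iUnion_fintype_le _ _).trans ?_
  have hj : ∀ j : A, noiseLaw n σ
      {e | σ * Real.sqrt (maxInvDiag X A * (2 / n) * Real.log A.card) ≤
        |inner ℝ (coefVec X A j) (WithLp.toLp 2 e)|} ≤
      ENNReal.ofReal (chiTail 1 (2 * Real.log A.card)) := by
    intro j
    have hle : σ * ‖coefVec X A j‖ * Real.sqrt (2 * Real.log A.card) ≤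
        σ * Real.sqrt (maxInvDiag X A * (2 / n) * Real.log A.card) := by
      rw [mul_assoc, ← Real.sqrt_sq (norm_nonneg (coefVec X A j)),
        ← Real.sqrt_mul (sq_nonneg _), h.norm_coefVec_sq hA]
      refine mul_le_mul_of_nonneg_left (Real.sqrt_le_sqrt ?_) hσ.le
      have := le_maxInvDiag (X := X) j
      calc (subGram X A)⁻¹ j j / n * (2 * Real.log A.card)
          ≤ maxInvDiag X A / n * (2 * Real.log A.card) := by gcongr
        _ = _ := by ring
    -- `noiseLaw_inner_le` needs a strictly positive threshold.
    have hpos : 0 < ‖coefVec X A j‖ := by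
      refine norm_pos_iff.2 fun h0 => ?_
      have h1 := h.inner_coefVec_fit hA j (c := Pi.single (j : Fin p) 1) fun i hi => by
        rw [Pi.single_eq_of_ne]
        rintro rfl
        exact hi j.2
      rw [h0, inner_zero_left, Pi.single_eq_same] at h1
      exact zero_ne_one h1
    have h2 : 0 < Real.sqrt (2 * Real.log A.card) := Real.sqrt_pos.2 (by linarith)
    exact noiseLaw_inner_le hσ _ hlog (lt_of_lt_of_le (by positivity) hle) hle
  refine (Finset.sum_le_sum fun j _ => hj j).trans ?_
  rw [Finset.sum_const, Finset.card_univ, Fintype.card_coe, nsmul_eq_mul,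
    ENNReal.ofReal_mul (Nat.cast_nonneg _), ENNReal.ofReal_natCast]

theorem noiseLaw_residCol_le (hn : 0 < n) (hσ : 0 < σ) (hX : ∀ j, ∑ k, X k j ^ 2 = n)
    (A : Finset (Fin p)) (hlog : 1 < 2 * Real.log p) :
    noiseLaw n σ (⋃ j : Fin p, {e | n * lamUniv n p σ ≤
      |inner ℝ (residCol X A j) (WithLp.toLp 2 e)|}) ≤
      ENNReal.ofReal (p * chiTail 1 (2 * Real.log p)) := by
  have hn' : (0 : ℝ) < n := by exact_mod_cast hn
  refine (measure_iUnion_fintype_le _ _).trans ?_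
  have hlam : n * lamUniv n p σ = σ * Real.sqrt n * Real.sqrt (2 * Real.log p) := by
    have h1 : (2 : ℝ) / n * Real.log p = 2 * Real.log p / n := by ring
    rw [lamUniv, h1, Real.sqrt_div (by linarith)]
    have h2 : Real.sqrt n ^ 2 = n := Real.sq_sqrt hn'.le
    have h3 : 0 < Real.sqrt n := Real.sqrt_pos.2 hn'
    nth_rewrite 1 [← h2]
    field_simp
  have h2 : 0 < Real.sqrt (2 * Real.log p) := Real.sqrt_pos.2 (by linarith)
  have hj : ∀ j : Fin p, noiseLaw n σ {e | n * lamUniv n p σ ≤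
      |inner ℝ (residCol X A j) (WithLp.toLp 2 e)|} ≤
      ENNReal.ofReal (chiTail 1 (2 * Real.log p)) := by
    intro j
    refine noiseLaw_inner_le hσ _ hlog ?_ ?_
    · rw [hlam]
      have := Real.sqrt_pos.2 hn'
      positivity
    · rw [hlam]
      have h3 : ‖residCol X A j‖ ≤ Real.sqrt n := by
        refine (norm_residCol_le j).trans (Real.le_sqrt_of_sq_le ?_)
        rw [norm_col_sq, hX j]
      gcongr
  refine (Finset.sum_le_sum fun j _ => hj j).trans ?_
  rw [Finset.sum_const, Finset.card_univ, Fintype.card_fin, nsmul_eq_mul,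
    ENNReal.ofReal_mul (Nat.cast_nonneg _), ENNReal.ofReal_natCast]

theorem SparseRiesz.noiseLaw_extraNoise_le (h : SparseRiesz X d cl cu) (hσ : 0 < σ)
    {O : Finset (Fin p)} (hO : O.card < d) (hdp : d < p) {t : ℝ} (ht : 1 ≤ t)
    (hteq : t - 1 - Real.log t =
      2 / ((d - O.card : ℕ) : ℝ) * Real.log ((p - O.card).choose (d - O.card))) :
    noiseLaw n σ (⋃ C ∈ Finset.powersetCard (d - O.card) Oᶜ,
      {e | σ ^ 2 * ((d - O.card : ℕ) * t) ≤ extraNoise X O (O ∪ C) e}) ≤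
      ENNReal.ofReal (Real.exp 1 / Real.sqrt (Real.log ((d - O.card : ℕ) + 1))) := by
  have hm : 0 < d - O.card := by omega
  obtain ⟨ht1, hbound⟩ := choose_mul_chiTail_le hm (by omega) ht hteq
  refine (measure_biUnion_finset_le _ _).trans ?_
  have hC : ∀ C ∈ Finset.powersetCard (d - O.card) Oᶜ, noiseLaw n σ
      {e | σ ^ 2 * ((d - O.card : ℕ) * t) ≤ extraNoise X O (O ∪ C) e} ≤
      ENNReal.ofReal (chiTail (d - O.card) t) := by
    intro C hC
    obtain ⟨hC1, hC2⟩ := Finset.mem_powersetCard.1 hC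
    have hdisj : Disjoint O C := by
      rw [Finset.disjoint_left]
      exact fun j hj hjC => Finset.mem_compl.1 (hC1 hjC) hj
    have hcard : (O ∪ C).card = d := by
      rw [Finset.card_union_of_disjoint hdisj, hC2]; omega
    have hrank := h.finrank_extraSpan hcard.le (O := O) Finset.subset_union_left
    rw [hcard] at hrank
    have := noiseLaw_proj_le hσ (extraSpan X O (O ∪ C)) (by omega) ht1
    rw [hrank] at this
    exact this
  refine (Finset.sum_le_sum hC).trans ?_
  rw [Finset.sum_const, Finset.card_powersetCard, Finset.card_compl, Fintype.card_fin,
    nsmul_eq_mul, ← ENNReal.ofReal_natCast, ← ENNReal.ofReal_mul (Nat.cast_nonneg _)]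
  exact ENNReal.ofReal_le_ofReal hbound

/-- A nonasymptotic bound for the probability that an MC+ estimate at the universal penalty level
differs from the oracle least squares estimate or has a wrong sign. -/
theorem SparseRiesz.prob_failure_le (hSRC : SparseRiesz X d cl cu) {Ω : Type*}
    [MeasurableSpace Ω] (P : Measure Ω) {noise : Ω → Fin n → ℝ} (hσ : 0 < σ)
    (hnoise : HasLaw noise (noiseLaw n σ) P) (hX : ∀ j, ∑ k, X k j ^ 2 = n) (hdp : d ≤ p)
    (hd : ((support β).card : ℝ) * (cu / cl + 1 / 2) ≤ d) (hd2 : 2 ≤ (support β).card)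
    (hγ : 2 ≤ γ * cl)
    (hβ : ∀ j, β j ≠ 0 →
      σ * Real.sqrt (maxInvDiag X (support β) * (2 / n) * Real.log (support β).card) +
        γ * max (2 * Real.sqrt cu * σ * Real.sqrt (2 / n *
            Real.log (pTilde p (support β).card (d - (support β).card) 1)))
          (lamUniv n p σ) ≤ |β j|) :
    P {ω | ∃ b : Fin p → ℝ,
        IsMCPlus X (fun k => X.mulVec β k + noise ω k) γ (lamUniv n p σ) b ∧
        (¬ IsLSE X (fun k => X.mulVec β k + noise ω k) (support β) b ∨
          ∃ j, Real.sign (b j) ≠ Real.sign (β j))} ≤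
      ENNReal.ofReal (Real.exp 1 / Real.sqrt (Real.log ((d - (support β).card : ℕ) + 1))) +
      ENNReal.ofReal ((support β).card * chiTail 1 (2 * Real.log (support β).card)) +
      ENNReal.ofReal (p * chiTail 1 (2 * Real.log p)) := by
  set O := support β with hO
  have hcl : 0 < cl := hSRC.1
  have hcu : 0 < cu := hcl.trans_le hSRC.2.1
  have hγ0 : 0 < γ := by
    by_contra hneg
    nlinarith [mul_nonneg_of_nonpos_of_nonpos (not_lt.1 hneg) (neg_nonpos.2 hcl.le)]
  have hK : 1 ≤ cu / cl := (one_le_div hcl).2 hSRC.2.1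
  have hO0 : (2 : ℝ) ≤ O.card := by exact_mod_cast hd2
  have hlt : O.card < d := by
    have : (O.card : ℝ) < d := by nlinarith
    exact_mod_cast this
  have hOp : O.card ≤ p := hlt.le.trans hdp
  have hn : 0 < n := hSRC.sample_size_pos hlt.le (Finset.card_pos.1 (by omega))
  have hn' : (0 : ℝ) < n := by exact_mod_cast hn
  have hlog2 : ∀ N : ℕ, 2 ≤ N → 1 < 2 * Real.log N := by
    intro N hN
    have h1 : Real.log 2 ≤ Real.log N :=
      Real.log_le_log two_pos (by exact_mod_cast hN)
    linarith [Real.log_two_gt_d9]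
  have hlogp := hlog2 p (hd2.trans hOp)
  have hl : 0 < lamUniv n p σ := by
    rw [lamUniv]
    have h1 : 0 < Real.log p := by linarith
    have : 0 < 2 / (n : ℝ) * Real.log p := by positivity
    exact mul_pos hσ (Real.sqrt_pos.2 this)
  obtain ⟨hq0, hq1, hq2⟩ := isPTilde_pTilde p O.card (d - O.card) one_pos le_rfl
  set q := pTilde p O.card (d - O.card) 1 with hq
  rw [div_one, Real.log_one, add_zero] at hq2
  set lam₁ := 2 * Real.sqrt cu * σ * Real.sqrt (2 / n * Real.log q) with hlam₁
  have hlam₁0 : 0 ≤ lam₁ := by positivity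
  -- The constant in λ₁ makes c^* σ² m t / n equal m λ₁²/4 for t = 2 log p̃₁, so the chi-squared
  -- threshold meets the rank bound.
  have hlam₁sq : lam₁ ^ 2 = 4 * cu * σ ^ 2 * (2 * Real.log q) / n := by
    have h1 : 0 ≤ Real.log q := by linarith
    rw [hlam₁, mul_pow, mul_pow, mul_pow, Real.sq_sqrt hcu.le, Real.sq_sqrt (by positivity)]
    ring
  set r := σ * Real.sqrt (maxInvDiag X O * (2 / n) * Real.log O.card) with hr
  have hβ0 : ∀ j ∉ O, β j = 0 := fun j hj => not_not.1 fun h => hj (mem_support.2 h)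
  -- For d = p no set of indices can exceed the rank, so no noise event is needed; this excludes the
  -- degenerate case t = 1.
  set B₁ : Set (Fin n → ℝ) := if d < p then (⋃ C ∈ Finset.powersetCard (d - O.card) Oᶜ,
      {e | σ ^ 2 * ((d - O.card : ℕ) * (2 * Real.log q)) ≤ extraNoise X O (O ∪ C) e}) else ∅
    with hB₁
  set B₂ : Set (Fin n → ℝ) :=
    ⋃ j : O, {e | r ≤ |inner ℝ (coefVec X O j) (WithLp.toLp 2 e)|} with hB₂
  set B₃ : Set (Fin n → ℝ) := ⋃ j : Fin p, {e | n * lamUniv n p σ ≤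
      |inner ℝ (residCol X O j) (WithLp.toLp 2 e)|} with hB₃
  have hB₁le : noiseLaw n σ B₁ ≤
      ENNReal.ofReal (Real.exp 1 / Real.sqrt (Real.log ((d - O.card : ℕ) + 1))) := by
    by_cases hdp' : d < p
    · rw [hB₁, if_pos hdp']
      exact hSRC.noiseLaw_extraNoise_le hσ hlt hdp' hq1 hq2
    · rw [hB₁, if_neg hdp', measure_empty]; exact zero_le
  refine le_trans (b := P (noise ⁻¹' (B₁ ∪ B₂ ∪ B₃))) (measure_mono ?_) ?_
  · intro ω hω
    by_contra hgood
    obtain ⟨b, hb, hfail⟩ := hω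
    simp only [Set.mem_preimage, Set.mem_union, not_or] at hgood
    obtain ⟨⟨h1, h2⟩, h3⟩ := hgood
    obtain ⟨bo, hbo⟩ := exists_isOracle X (fun k => X.mulVec β k + noise ω k) O
    have herr : ∀ j ∈ O, |bo j - β j| < r := by
      intro j hj
      rw [hbo.sub_eq hSRC hlt.le hβ0 ⟨j, hj⟩]
      by_contra hcon
      exact h2 (Set.mem_iUnion.2 ⟨⟨j, hj⟩, not_lt.1 hcon⟩)
    have hnoise' : d < p → ∀ A, O ⊆ A → A.card = d →
        cu * (extraNoise X O A (noise ω) / n) ≤ ((d : ℝ) - O.card) * lam₁ ^ 2 / 4 := by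
      intro hdp' A hOA hA
      rw [hB₁, if_pos hdp'] at h1
      have h4 : extraNoise X O A (noise ω) ≤ σ ^ 2 * ((d - O.card : ℕ) * (2 * Real.log q)) := by
        by_contra hcon
        refine h1 (Set.mem_iUnion₂.2 ⟨A \ O, Finset.mem_powersetCard.2 ⟨?_, ?_⟩, ?_⟩)
        · intro j hj
          exact Finset.mem_compl.2 (Finset.mem_sdiff.1 hj).2
        · rw [Finset.card_sdiff_of_subset hOA, hA]
        · rw [Finset.union_sdiff_of_subset hOA]
          exact (not_le.1 hcon).le
      rw [Nat.cast_sub hlt.le] at h4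
      rw [hlam₁sq]
      calc cu * (extraNoise X O A (noise ω) / n)
          ≤ cu * (σ ^ 2 * (((d : ℝ) - O.card) * (2 * Real.log q)) / n) := by gcongr
        _ = _ := by ring
    have hbig : ∀ j ∈ O, γ * max lam₁ (lamUniv n p σ) ≤ |bo j| := by
      intro j hj
      have h4 := hβ j (mem_support.1 hj)
      have h5 := herr j hj
      have h6 : |β j| ≤ |bo j| + |bo j - β j| := by
        have := abs_sub (bo j) (bo j - β j)
        rwa [sub_sub_cancel] at this
      linarith
    have hsmall : ∀ j ∉ O, |corr X (fun k => X.mulVec β k + noise ω k) bo j| < lamUniv n p σ := by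
      intro j _
      rw [hbo.corr_eq hβ0 j, abs_div, Nat.abs_cast, div_lt_iff₀ hn', mul_comm]
      by_contra hcon
      exact h3 (Set.mem_iUnion.2 ⟨j, not_lt.1 hcon⟩)
    have heq := hb.eq_oracle hSRC hd hlt hγ hγ0 hl hlam₁0 hbo hnoise' hbig hsmall
    rw [heq] at hfail
    rcases hfail with hfail | ⟨j, hj⟩
    · exact hfail hbo.isLSE
    · by_cases hjO : j ∈ O
      · refine hj (sign_eq_of_abs_sub_lt ((herr j hjO).trans_le ?_))
        have h4 := hβ j (mem_support.1 hjO)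
        have h5 : 0 ≤ γ * max lam₁ (lamUniv n p σ) :=
          mul_nonneg hγ0.le (hlam₁0.trans (le_max_left _ _))
        linarith
      · exact hj (by rw [hbo.eq_zero j hjO, hβ0 j hjO])
  -- This inequality holds for arbitrary sets, so no measurability of the exceptional sets is
  -- needed.
  · refine (Measure.le_map_apply hnoise.aemeasurable _).trans ?_
    rw [hnoise.map_eq]
    refine (measure_union_le _ _).trans (add_le_add ((measure_union_le _ _).trans
      (add_le_add hB₁le ?_)) ?_)
    · exact hSRC.noiseLaw_coefVec_le hσ hlt.le hd2 (hlog2 _ hd2)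
    · exact noiseLaw_residCol_le hn hσ hX O hlogp

end Probability

end MCPlus

/-! ### Passage to the limit -/

theorem corollary1
    -- sample size, number of predictors, rank in the sparse Riesz condition
    (n p dstar : ℕ → ℕ)
    -- noise level, the constants c_* and c^*, regularization parameter of the penalty
    (σ cl cu γ : ℕ → ℝ)
    (X : ∀ i, Matrix (Fin (n i)) (Fin (p i)) ℝ)
    (β : ∀ i, Fin (p i) → ℝ)
    {Ω : ℕ → Type*} [∀ i, MeasurableSpace (Ω i)]
    (P : ∀ i, MeasureTheory.Measure (Ω i)) [∀ i, MeasureTheory.IsProbabilityMeasure (P i)]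
    (noise : ∀ i, Ω i → Fin (n i) → ℝ)
    (hσ : ∀ i, 0 < σ i)
    -- the noise vector has the law N(0, σ² I_n)
    (hnoise : ∀ i, ProbabilityTheory.HasLaw (noise i)
      (MeasureTheory.Measure.pi fun _ : Fin (n i) =>
        ProbabilityTheory.gaussianReal 0 (Real.toNNReal (σ i ^ 2))) (P i))
    (hX : ∀ i j, ∑ k, X i k j ^ 2 = n i)
    (hdp : ∀ i, dstar i ≤ p i)
    (hSRC : ∀ i, MCPlus.SparseRiesz (X i) (dstar i) (cl i) (cu i))
    (hd : ∀ i, ((MCPlus.support (β i)).card : ℝ) ≤ dstar i / (cu i / cl i + 1 / 2))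
    (hd_top : Filter.Tendsto (fun i => (MCPlus.support (β i)).card) Filter.atTop Filter.atTop)
    (hγ : ∀ i, (cl i)⁻¹ * Real.sqrt (4 + cl i / cu i) ≤ γ i)
    (hβ : ∀ i j, β i j ≠ 0 →
      σ i * Real.sqrt (MCPlus.maxInvDiag (X i) (MCPlus.support (β i)) * (2 / n i) *
          Real.log (MCPlus.support (β i)).card) +
        γ i * max
          (2 * Real.sqrt (cu i) * σ i * Real.sqrt (2 / n i *
            Real.log (MCPlus.pTilde (p i) (MCPlus.support (β i)).card
              (dstar i - (MCPlus.support (β i)).card) 1)))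
          (MCPlus.lamUniv (n i) (p i) (σ i)) ≤ |β i j|) :
    -- the (outer) probability that an MC+ estimate at the universal penalty level differs from
    -- the oracle least squares estimate or has a wrong sign tends to zero
    Filter.Tendsto
      (fun i => P i {ω | ∃ b : Fin (p i) → ℝ,
        MCPlus.IsMCPlus (X i) (fun k => (X i).mulVec (β i) k + noise i ω k) (γ i)
          (MCPlus.lamUniv (n i) (p i) (σ i)) b ∧
        (¬ MCPlus.IsLSE (X i) (fun k => (X i).mulVec (β i) k + noise i ω k)
            (MCPlus.support (β i)) b ∨
          ∃ j, Real.sign (b j) ≠ Real.sign (β i j))})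
      Filter.atTop (nhds 0) := by
  have hcard_le : ∀ i, (MCPlus.support (β i)).card * (cu i / cl i + 1 / 2) ≤ (dstar i : ℝ) := by
    intro i
    have hcl := (hSRC i).1
    have hcu := hcl.trans_le (hSRC i).2.1
    exact (le_div_iff₀ (by positivity)).1 (hd i)
  have hK : ∀ i, 1 ≤ cu i / cl i := fun i => (one_le_div (hSRC i).1).2 (hSRC i).2.1
  -- Since K ≥ 1, d is at least 3|O|/2, so m grows at least like |O|/2.
  have hgap : ∀ i, (MCPlus.support (β i)).card / 2 ≤
      dstar i - (MCPlus.support (β i)).card := by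
    intro i
    have h0 : (0 : ℝ) ≤ (MCPlus.support (β i)).card := Nat.cast_nonneg _
    have h1 : 3 * ((MCPlus.support (β i)).card : ℝ) ≤ 2 * dstar i := by
      nlinarith [hcard_le i, hK i]
    have h2 : 3 * (MCPlus.support (β i)).card ≤ 2 * dstar i := by exact_mod_cast h1
    omega
  have hm_top : Tendsto (fun i => dstar i - (MCPlus.support (β i)).card) atTop atTop :=
    tendsto_atTop_mono hgap ((Nat.tendsto_div_const_atTop two_ne_zero).comp hd_top)
  have hp_top : Tendsto p atTop atTop :=
    tendsto_atTop_mono (fun i => by simpa using Finset.card_le_univ (MCPlus.support (β i))) hd_top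
  have hlim₁ : Tendsto (fun i => Real.exp 1 /
      Real.sqrt (Real.log ((dstar i - (MCPlus.support (β i)).card : ℕ) + 1))) atTop (𝓝 0) := by
    refine Tendsto.const_div_atTop (Real.tendsto_sqrt_atTop.comp (Real.tendsto_log_atTop.comp ?_)) _
    exact tendsto_atTop_add_const_right _ _ (tendsto_natCast_atTop_atTop.comp hm_top)
  have hlim := ((ENNReal.tendsto_ofReal hlim₁).add
    (ENNReal.tendsto_ofReal (MCPlus.tendsto_mul_chiTail_one.comp hd_top))).add
    (ENNReal.tendsto_ofReal (MCPlus.tendsto_mul_chiTail_one.comp hp_top))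
  simp only [ENNReal.ofReal_zero, add_zero] at hlim
  refine tendsto_of_tendsto_of_tendsto_of_le_of_le' tendsto_const_nhds hlim
    (Eventually.of_forall fun i => zero_le) ?_
  -- From |O| = 2 on, 2 log |O| exceeds 1, as the tail bounds require.
  filter_upwards [hd_top.eventually_ge_atTop 2] with i hi
  have hcl := (hSRC i).1
  have hcu := hcl.trans_le (hSRC i).2.1
  have hγcl : 2 ≤ γ i * cl i := by
    have h1 : 2 ≤ Real.sqrt (4 + cl i / cu i) := by
      refine Real.le_sqrt_of_sq_le ?_
      have : 0 < cl i / cu i := by positivity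
      linarith
    have h2 := hγ i
    rw [inv_mul_le_iff₀ hcl] at h2
    linarith
  exact (hSRC i).prob_failure_le (P i) (hσ i) (hnoise i) (hX i) (hdp i) (hcard_le i) hi hγcl (hβ i)
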